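/- **Setting.** Let $D=\mathbb R_{\ge 0}$ or $D=\mathbb R$, $T>0$, and let $X=(X_t)_{0\le t\le T}$ be a $D$-valued process on a measurable space $(\Omega,\mathcal A)$, adapted to a filtration $(\mathcal F_t)$, which is a time-homogeneous Markov process under a family of probability measures $(\mathbb P^x)_{x\in D}$ with $\mathbb P^x(X_0=x)=1$. Let $X$ be an analytic affine process: it is stochastically continuous; for $v\in i\mathbb R$, $x\in D$, $t\le T$ one has $\mathbb E^x[e^{vX_t}]=e^{\phi_t(v)+\psi_t(v)x}$ for some functions $\phi_t,\psi_t$; and $0$ is an interior point of $$\mathcal V=\Big\{v\in\mathbb C:\ \sup_{0\le s\le T}\mathbb E^x[e^{\mathrm{Re}(v)X_s}]<\infty\ \text{ for all } x\in D\Big\}.$$ Fix $x_0\in D$ and put $\mathbb Q^T=\mathbb P^{x_0}$. Let $N\ge1$, $0<T_1<\dots<T_N\le T_{N+1}=T$, $\Delta_k=T_k-T_{k-1}$, and $u_1>\dots>u_N\ge 0$ with $\pm u_k\in\mathcal V$; put $u_{N+1}=0$. Let $P(t,T_k)$, $0\le t\le T_k$, $1\le k\le N+1$, be adapted bond prices with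 $P(T_k,T_k)=1$ and $P(t,T)>0$ a.s. such that (modified affine LIBOR model) $$\frac{P(t,T_k)}{P(t,T)}=\mathbb E^{\mathbb Q^T}[\cosh(u_kX_T)\mid\mathcal F_t],\qquad t\le T_k,\ 1\le k\le N .$$ Let $\mathbb Q^{T_k}$ be the forward measure, $\dfrac{d\mathbb Q^{T_k}}{d\mathbb Q^T}=\dfrac{1}{P(T_k,T)}\dfrac{P(0,T)}{P(0,T_k)}$, and define $$F^k(t)=\frac1{\Delta_k}\Big(\frac{P(t,T_{k-1})}{P(t,T_k)}-1\Big),\qquad S_{\alpha,\beta}(t)=\frac{P(t,T_\alpha)-P(t,T_\beta)}{\sum_{k=\alpha+1}^\beta\Delta_kP(t,T_k)},$$ $$\mathrm{Flt}(t,T_k,T_{k+1},K)=P(t,T_{k+1})\,\mathbb E^{\mathbb Q^{T_{k+1}}}\big[\Delta_{k+1}(K-F^{k+1}(T_k))_+\mid\mathcal F_t\big],$$ $$\mathrm{PutSwaption}(t,T_\alpha,T_\beta,K)=P(t,T_\alpha)\,\mathbb E^{\mathbb Q^{T_\alpha}}\Big[\sum_{k=\alpha+1}^\beta P(T_\alpha,T_k)\Delta_k(K-S_{\alpha,\beta}(T_\alpha))_+\,\Big|\,\mathcal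 F_t\Big].$$ (If $T_N=T_{N+1}$, so that $\Delta_{N+1}=0$, the floorlet payoff for $k=N$ is understood to be $0$.) **Theorem.** (a) There are real functions $\phi_t,\psi_t$ on $\mathcal V\cap\mathbb R$ with $\mathbb E^x[e^{vX_t}]=e^{\phi_t(v)+\psi_t(v)x}$ for all $t\le T$, $v\in\mathcal V\cap\mathbb R$, $x\in D$ (they are unique, since $0,1\in D$). For $s\le t\le T$ and $z\in\mathcal V$ the conditional moment generating function is $\mathcal M_{X_t|X_s}(z):=\mathbb E^{\mathbb Q^T}[e^{zX_t}\mid\mathcal F_s]=\mathbb E^{x}[e^{zX_{t-s}}]\big|_{x=X_s}$ a.s.; the last expression is the version used below. The $\mathbb Q^{T_k}$ are probability measures, and a.s. $P(t,T_k)/P(t,T)=M_t^{u_k}(X_t)$ for $1\le k\le N$ and $t\le T_k$, where $$M_t^v(x)=\tfrac12\big(e^{\phi_{T-t}(v)+\psi_{T-t}(v)x}+e^{\phi_{T-t}(-v)+\psi_{T-t}(-v)x}\big).$$ For $z\in\mathbb C$, $t\le T$, $\kappa_1\le\kappa_2$ let $$h^t_{\kappa_1,\kappa_2}(z,v)=\sum_{w\in\{v,-v\}}e^{\phi_{T-t}(w)}\frac{\psi_{T-t}(w)}{2(z+\psi_{T-t}(w))}\big(e^{(z+\psi_{T-t}(w))\kappa_2}-e^{(z+\psi_{T-t}(w))\kappa_1}\big)$$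 (both signs are summed, also if $v=0$), and for a bounded function $f$ with compact support let $\hat f(z)=\int_{\mathbb R}f(x)e^{-izx}\,dx$. (b) (Floorlets.) Let $K\in\mathbb R$ and $1\le k\le N$ with $u_k>u_{k+1}$. The payoff is $\mathbb Q^{T_{k+1}}$-integrable. The function $g(x)=1+\Delta_{k+1}K-M^{u_k}_{T_k}(x)/M^{u_{k+1}}_{T_k}(x)$ has a unique maximum point $\xi\in\mathbb R$, and there is a unique pair $\kappa_1\le\xi\le\kappa_2$ such that $g>0$ exactly on $(\kappa_1,\kappa_2)$ and, if $g(\xi)\ge0$, $g(\kappa_1)=g(\kappa_2)=0$ (if $g<0$ everywhere, $\kappa_1=\xi=\kappa_2$). With $$f^K_{k+1}(x)=\big((1+\Delta_{k+1}K)M^{u_{k+1}}_{T_k}(x)-M^{u_k}_{T_k}(x)\big)\mathbf 1_{\{\kappa_1<x<\kappa_2\}},$$ for every $R\in\mathcal V\cap\mathbb R$ and $t\le T_k$ one has, a.s. and with an absolutely convergent integral, $$\mathrm{Flt}(t,T_k,T_{k+1},K)=\frac{P(t,T)}{\pi}\int_0^\infty\mathrm{Re}\Big(\mathcal M_{X_{T_k}|X_t}(R+iu)\,\hat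 f^K_{k+1}(u-iR)\Big)du,$$ $$\hat f^K_{k+1}(z)=\frac1{iz}\Big((1+\Delta_{k+1}K)\,h^{T_k}_{\kappa_1,\kappa_2}(-iz,u_{k+1})-h^{T_k}_{\kappa_1,\kappa_2}(-iz,u_k)\Big)$$ for all $z\in\mathbb C$ with $iz\notin\{0\}\cup\{\psi_{T-T_k}(\pm u_j):j=k,k+1\}$; in particular for $z=u-iR$ with $u>0$ and any real $R$. (c) (Put swaptions.) Let $K\ge0$ and $1\le\alpha<\beta\le N$. The payoff is $\mathbb Q^{T_\alpha}$-integrable. The function $$g(x)=\frac{M^{u_\beta}_{T_\alpha}(x)}{M^{u_\alpha}_{T_\alpha}(x)}+\sum_{k=\alpha+1}^\beta K\Delta_k\frac{M^{u_k}_{T_\alpha}(x)}{M^{u_\alpha}_{T_\alpha}(x)}-1$$ has a unique maximum point and determines a unique pair $\kappa_1\le\kappa_2$ in the same way as in (b). With $$f^K_{\alpha,\beta}(x)=\Big(M^{u_\beta}_{T_\alpha}(x)-M^{u_\alpha}_{T_\alpha}(x)+\sum_{k=\alpha+1}^\beta K\Delta_kM^{u_k}_{T_\alpha}(x)\Big)\mathbf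 1_{\{\kappa_1<x<\kappa_2\}},$$ for every $R\in\mathcal V\cap\mathbb R$ and $t\le T_\alpha$ one has, a.s. and with an absolutely convergent integral, $$\mathrm{PutSwaption}(t,T_\alpha,T_\beta,K)=\frac{P(t,T)}{\pi}\int_0^\infty\mathrm{Re}\Big(\mathcal M_{X_{T_\alpha}|X_t}(R+iu)\,\hat f^K_{\alpha,\beta}(u-iR)\Big)du,$$ $$\hat f^K_{\alpha,\beta}(z)=\frac1{iz}\Big(h^{T_\alpha}_{\kappa_1,\kappa_2}(-iz,u_\beta)-h^{T_\alpha}_{\kappa_1,\kappa_2}(-iz,u_\alpha)+K\sum_{k=\alpha+1}^\beta\Delta_k\,h^{T_\alpha}_{\kappa_1,\kappa_2}(-iz,u_k)\Big)$$ for all $z\in\mathbb C$ with $iz\notin\{0\}\cup\{\psi_{T-T_\alpha}(\pm u_j):\alpha\le j\le\beta\}$. -/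

import Mathlib

open MeasureTheory ProbabilityTheory Set Filter Topology
open scoped NNReal ENNReal

noncomputable section

namespace AffineLibor

/-! ### One-dimensional analytic affine processes

`X` is a process with values in `D`, realized on one measurable space `Ω` with filtration `𝓕`;
`P x` is the probability measure under which `X` starts in `x`, and `T` is the time horizon.
Only times in `[0, T]` matter. -/

section Affine

variable {Ω : Type*} {mΩ : MeasurableSpace Ω} {D : Set ℝ}

/-- `X` is a time-homogeneous Markov process on `[0, T]` with respect to `𝓕` under the family
of laws `(P x)`: it is adapted, starts in `x` under `P x`, and
`P^x(X_{s+h} ∈ A | 𝓕_s) = P^{X_s}(X_h ∈ A)`. -/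
structure IsHomogeneousMarkov (𝓕 : Filtration ℝ≥0 mΩ) (X : ℝ≥0 → Ω → D) (P : Kernel D Ω)
    (T : ℝ≥0) : Prop where
  adapted : ∀ t ≤ T, Measurable[𝓕 t] (X t)
  initial : ∀ x : D, ∀ᵐ ω ∂(P x), X 0 ω = x
  markov : ∀ (x : D) (s h : ℝ≥0), s + h ≤ T → ∀ A : Set D, MeasurableSet A →
    (P x)[(X (s + h) ⁻¹' A).indicator (fun _ => (1 : ℝ)) | 𝓕 s]
      =ᵐ[P x] fun ω => (P (X s ω)).real (X h ⁻¹' A)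

/-- The set `𝒱` of all complex `u` with `sup_{0 ≤ s ≤ T} E^x[exp(Re(u) X_s)] < ∞` for all
`x ∈ D`. -/
def momentSet (X : ℝ≥0 → Ω → D) (P : Kernel D Ω) (T : ℝ≥0) : Set ℂ :=
  {u | ∀ x : D, ⨆ s ∈ Iic T, ∫⁻ ω, ENNReal.ofReal (Real.exp (u.re * (X s ω : ℝ))) ∂(P x) < ⊤}

/-- The moment generating function `E^x[exp(z X_h)]`. By the Markov property,
`mgfFrom X P (t - s) z (X s ω)` is the conditional moment generating function of `X_t` given
`X_s`. -/
def mgfFrom (X : ℝ≥0 → Ω → D) (P : Kernel D Ω) (h : ℝ≥0) (z : ℂ) (x : D) : ℂ :=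
  ∫ ω, Complex.exp (z * ((X h ω : ℝ) : ℂ)) ∂(P x)

/-- `X` is a one-dimensional analytic affine process: its state space is `ℝ_{≥0}` or `ℝ`, it is a
homogeneous Markov process whose characteristic function is exponentially affine in the starting
value, it is stochastically continuous, and `0` is an interior point of `𝒱`. -/
structure IsAnalyticAffine (𝓕 : Filtration ℝ≥0 mΩ) (X : ℝ≥0 → Ω → D) (P : Kernel D Ω)
    (T : ℝ≥0) : Prop where
  stateSpace : D = Ici 0 ∨ D = univ
  isMarkov : IsHomogeneousMarkov 𝓕 X P T
  affine : ∃ φ ψ : ℝ≥0 → ℂ → ℂ, ∀ t ≤ T, ∀ v : ℂ, v.re = 0 → ∀ x : D,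
    mgfFrom X P t v x = Complex.exp (φ t v + ψ t v * ((x : ℝ) : ℂ))
  stochCont : ∀ x : D, ∀ t ≤ T,
    TendstoInMeasure (P x) (fun s ω => (X s ω : ℝ)) (𝓝[Iic T] t) (fun ω => (X t ω : ℝ))
  zero_mem : (0 : ℂ) ∈ interior (momentSet X P T)

/-- `φ` and `ψ` are the exponents of the affine process at the real points `v` of `𝒱`:
`E^x[exp(v X_t)] = exp(φ_t(v) + ψ_t(v) x)` for all `x ∈ D` and `t ≤ T`. As `D` contains `0` and
`1`, this determines `φ_t(v)` and `ψ_t(v)`. -/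
def IsExponentPair (X : ℝ≥0 → Ω → D) (P : Kernel D Ω) (T : ℝ≥0) (φ ψ : ℝ≥0 → ℝ → ℝ) : Prop :=
  ∀ t ≤ T, ∀ v : ℝ, (v : ℂ) ∈ momentSet X P T → ∀ x : D,
    ∫ ω, Real.exp (v * (X t ω : ℝ)) ∂(P x) = Real.exp (φ t v + ψ t v * (x : ℝ))

end Affine

/-! ### The bond market -/

section Market

variable {Ω : Type*} {mΩ : MeasurableSpace Ω} {D : Set ℝ}

/-- The modified affine LIBOR model for the tenor structure
`0 < τ 1 < ⋯ < τ N ≤ τ (N + 1) = T`, where `B k t` is the price at time `t` of the zero coupon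
bond with maturity `τ k`, and `Q` is the martingale measure for the numeraire `B (N + 1)`.
The parameters `u 1 > ⋯ > u N ≥ 0` are such that `±u k` lies in `V`. Since the
bond ratio of index `N + 1` is `1`, the sequence is continued by `u (N + 1) = 0`. -/
structure IsModifiedAffineLibor (𝓕 : Filtration ℝ≥0 mΩ) (X : ℝ≥0 → Ω → D) (Q : Measure Ω)
    (V : Set ℂ) (N : ℕ) (τ : ℕ → ℝ≥0) (u : ℕ → ℝ) (B : ℕ → ℝ≥0 → Ω → ℝ) : Prop where
  one_le : 1 ≤ N
  tenor_pos : 0 < τ 1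
  tenor_lt : StrictMonoOn τ (Icc 1 N)
  tenor_last : τ N ≤ τ (N + 1)
  u_nonneg : ∀ k ∈ Icc 1 N, 0 ≤ u k
  u_mem : ∀ k ∈ Icc 1 N, (u k : ℂ) ∈ V
  neg_u_mem : ∀ k ∈ Icc 1 N, -(u k : ℂ) ∈ V
  u_strictAnti : StrictAntiOn u (Icc 1 N)
  u_last : u (N + 1) = 0
  bond_adapted : ∀ k ∈ Icc 1 (N + 1), ∀ t ≤ τ k, Measurable[𝓕 t] (B k t)
  numeraire_pos : ∀ t ≤ τ (N + 1), ∀ᵐ ω ∂Q, 0 < B (N + 1) t ω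
  bond_maturity : ∀ k ∈ Icc 1 (N + 1), ∀ᵐ ω ∂Q, B k (τ k) ω = 1
  bond_ratio : ∀ k ∈ Icc 1 N, ∀ t ≤ τ k,
    (fun ω => B k t ω / B (N + 1) t ω)
      =ᵐ[Q] Q[fun ω => Real.cosh (u k * (X (τ (N + 1)) ω : ℝ)) | 𝓕 t]

/-- The length `Δ_k = T_k - T_{k-1}` (used for `k ≥ 2` only). -/
def accrual (τ : ℕ → ℝ≥0) (k : ℕ) : ℝ := (τ k : ℝ) - (τ (k - 1) : ℝ)

/-- The forward measure `Q^{T_k}`, with density `P(0,T) / (P(T_k,T) P(0,T_k))` with respect to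
`Q = Q^T`, where `T = T_{N+1}`. -/
def forwardMeasure (Q : Measure Ω) (N : ℕ) (τ : ℕ → ℝ≥0) (B : ℕ → ℝ≥0 → Ω → ℝ) (k : ℕ) :
    Measure Ω :=
  Q.withDensity fun ω =>
    ENNReal.ofReal (1 / B (N + 1) (τ k) ω * (B (N + 1) 0 ω / B k 0 ω))

/-- The forward interest rate `F^k(t) = (P(t,T_{k-1}) / P(t,T_k) - 1) / Δ_k` (for `k ≥ 2`). -/
def forwardRate (τ : ℕ → ℝ≥0) (B : ℕ → ℝ≥0 → Ω → ℝ) (k : ℕ) (t : ℝ≥0) (ω : Ω) : ℝ :=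
  1 / accrual τ k * (B (k - 1) t ω / B k t ω - 1)

/-- The payoff `Δ_{k+1} (K - F^{k+1}(T_k))_+` of a floorlet, paid at time `T_{k+1}`. -/
def floorletPayoff (τ : ℕ → ℝ≥0) (B : ℕ → ℝ≥0 → Ω → ℝ) (k : ℕ) (K : ℝ) (ω : Ω) : ℝ :=
  accrual τ (k + 1) * max (K - forwardRate τ B (k + 1) (τ k) ω) 0

/-- The floorlet price `P(t,T_{k+1}) E^{Q^{T_{k+1}}}[payoff | 𝓕_t]`. -/
def floorletPrice (𝓕 : Filtration ℝ≥0 mΩ) (Q : Measure Ω) (N : ℕ) (τ : ℕ → ℝ≥0)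
    (B : ℕ → ℝ≥0 → Ω → ℝ) (t : ℝ≥0) (k : ℕ) (K : ℝ) (ω : Ω) : ℝ :=
  B (k + 1) t ω * ((forwardMeasure Q N τ B (k + 1))[floorletPayoff τ B k K | 𝓕 t]) ω

/-- The forward swap rate
`S_{α,β}(t) = (P(t,T_α) - P(t,T_β)) / ∑_{k=α+1}^β Δ_k P(t,T_k)`. -/
def swapRate (τ : ℕ → ℝ≥0) (B : ℕ → ℝ≥0 → Ω → ℝ) (α β : ℕ) (t : ℝ≥0) (ω : Ω) : ℝ :=
  (B α t ω - B β t ω) / ∑ k ∈ Finset.Icc (α + 1) β, accrual τ k * B k t ω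

/-- The payoff `∑_{k=α+1}^β P(T_α,T_k) Δ_k (K - S_{α,β}(T_α))_+` of a put swaption, paid at
time `T_α`. -/
def putSwaptionPayoff (τ : ℕ → ℝ≥0) (B : ℕ → ℝ≥0 → Ω → ℝ) (α β : ℕ) (K : ℝ) (ω : Ω) : ℝ :=
  ∑ k ∈ Finset.Icc (α + 1) β,
    B k (τ α) ω * accrual τ k * max (K - swapRate τ B α β (τ α) ω) 0

/-- The put swaption price `P(t,T_α) E^{Q^{T_α}}[payoff | 𝓕_t]`. -/
def putSwaptionPrice (𝓕 : Filtration ℝ≥0 mΩ) (Q : Measure Ω) (N : ℕ) (τ : ℕ → ℝ≥0)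
    (B : ℕ → ℝ≥0 → Ω → ℝ) (t : ℝ≥0) (α β : ℕ) (K : ℝ) (ω : Ω) : ℝ :=
  B α t ω * ((forwardMeasure Q N τ B α)[putSwaptionPayoff τ B α β K | 𝓕 t]) ω

end Market

/-! ### The functions in the pricing formulas -/

section Formulas

/-- The function `M_t^v(x)`, for `t ≤ T`. -/
def coshFun (φ ψ : ℝ≥0 → ℝ → ℝ) (T t : ℝ≥0) (v x : ℝ) : ℝ :=
  (Real.exp (φ (T - t) v + ψ (T - t) v * x)
    + Real.exp (φ (T - t) (-v) + ψ (T - t) (-v) * x)) / 2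

/-- The function `h^t_{κ₁,κ₂}(z, v)`, for `t ≤ T`. -/
def hFun (φ ψ : ℝ≥0 → ℝ → ℝ) (T t : ℝ≥0) (κ₁ κ₂ : ℝ) (z : ℂ) (v : ℝ) : ℂ :=
  Complex.exp (φ (T - t) v) * (ψ (T - t) v / (2 * (z + ψ (T - t) v)))
      * (Complex.exp ((z + ψ (T - t) v) * κ₂) - Complex.exp ((z + ψ (T - t) v) * κ₁))
    + Complex.exp (φ (T - t) (-v)) * (ψ (T - t) (-v) / (2 * (z + ψ (T - t) (-v))))
      * (Complex.exp ((z + ψ (T - t) (-v)) * κ₂) - Complex.exp ((z + ψ (T - t) (-v)) * κ₁))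

/-- The extended Fourier transform `z ↦ ∫ f(x) exp(-i z x) dx`. -/
def fourierExt (f : ℝ → ℝ) (z : ℂ) : ℂ :=
  ∫ x : ℝ, Complex.exp (-Complex.I * z * x) * (f x : ℂ)

/-- `g` has a unique global maximum point `ξ`, `κ₁ ≤ ξ ≤ κ₂`, `g` is positive exactly on
`(κ₁, κ₂)`, and `κ₁, κ₂` are roots of `g` unless `g` is negative everywhere (in which case
`κ₁ = ξ = κ₂`). -/
def IsPayoffInterval (g : ℝ → ℝ) (κ₁ κ₂ : ℝ) : Prop :=
  (∀ x, 0 < g x ↔ κ₁ < x ∧ x < κ₂) ∧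
  ∃ ξ, κ₁ ≤ ξ ∧ ξ ≤ κ₂ ∧ (∀ x, x ≠ ξ → g x < g ξ) ∧ (0 ≤ g ξ → g κ₁ = 0 ∧ g κ₂ = 0)

/-- The integrand `𝓜(R + i y) f̂(y - i R)` of the pricing formulas, where `𝓜` is the moment
generating function of `X_h` started in `x`. -/
def pricingIntegrand {Ω : Type*} {mΩ : MeasurableSpace Ω} {D : Set ℝ} (X : ℝ≥0 → Ω → D)
    (P : Kernel D Ω) (h : ℝ≥0) (f : ℝ → ℝ) (R : ℝ) (x : D) (y : ℝ) : ℂ :=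
  mgfFrom X P h (R + Complex.I * y) x * fourierExt f (y - Complex.I * R)

variable (φ ψ : ℝ≥0 → ℝ → ℝ) (N : ℕ) (τ : ℕ → ℝ≥0) (u : ℕ → ℝ)

/-- `1 + Δ_{k+1} K - M_{T_k}^{u_k}(x) / M_{T_k}^{u_{k+1}}(x)`. -/
def floorletRootFun (k : ℕ) (K x : ℝ) : ℝ :=
  (1 + accrual τ (k + 1) * K)
    - coshFun φ ψ (τ (N + 1)) (τ k) (u k) x / coshFun φ ψ (τ (N + 1)) (τ k) (u (k + 1)) x

/-- `((1 + Δ_{k+1} K) M_{T_k}^{u_{k+1}}(x) - M_{T_k}^{u_k}(x)) 1_{κ₁ < x < κ₂}`. -/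
def floorletFun (k : ℕ) (K κ₁ κ₂ : ℝ) : ℝ → ℝ :=
  (Ioo κ₁ κ₂).indicator fun x =>
    (1 + accrual τ (k + 1) * K) * coshFun φ ψ (τ (N + 1)) (τ k) (u (k + 1)) x
      - coshFun φ ψ (τ (N + 1)) (τ k) (u k) x

/-- The explicit form of the Fourier transform of `floorletFun`. -/
def floorletHat (k : ℕ) (K κ₁ κ₂ : ℝ) (z : ℂ) : ℂ :=
  1 / (Complex.I * z) *
    ((1 + accrual τ (k + 1) * K) *
        hFun φ ψ (τ (N + 1)) (τ k) κ₁ κ₂ (-Complex.I * z) (u (k + 1))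
      - hFun φ ψ (τ (N + 1)) (τ k) κ₁ κ₂ (-Complex.I * z) (u k))

/-- `M_{T_α}^{u_β}(x) / M_{T_α}^{u_α}(x)
  + ∑_{k=α+1}^β K Δ_k M_{T_α}^{u_k}(x) / M_{T_α}^{u_α}(x) - 1`. -/
def swaptionRootFun (α β : ℕ) (K x : ℝ) : ℝ :=
  coshFun φ ψ (τ (N + 1)) (τ α) (u β) x / coshFun φ ψ (τ (N + 1)) (τ α) (u α) x
    + ∑ k ∈ Finset.Icc (α + 1) β, K * accrual τ k *
        (coshFun φ ψ (τ (N + 1)) (τ α) (u k) x / coshFun φ ψ (τ (N + 1)) (τ α) (u α) x)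
    - 1

/-- `(M_{T_α}^{u_β}(x) - M_{T_α}^{u_α}(x) + ∑_{k=α+1}^β K Δ_k M_{T_α}^{u_k}(x))
  1_{κ₁ < x < κ₂}`. -/
def swaptionFun (α β : ℕ) (K κ₁ κ₂ : ℝ) : ℝ → ℝ :=
  (Ioo κ₁ κ₂).indicator fun x =>
    coshFun φ ψ (τ (N + 1)) (τ α) (u β) x - coshFun φ ψ (τ (N + 1)) (τ α) (u α) x
      + ∑ k ∈ Finset.Icc (α + 1) β, K * accrual τ k * coshFun φ ψ (τ (N + 1)) (τ α) (u k) x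

/-- The explicit form of the Fourier transform of `swaptionFun`. -/
def swaptionHat (α β : ℕ) (K κ₁ κ₂ : ℝ) (z : ℂ) : ℂ :=
  1 / (Complex.I * z) *
    (hFun φ ψ (τ (N + 1)) (τ α) κ₁ κ₂ (-Complex.I * z) (u β)
      - hFun φ ψ (τ (N + 1)) (τ α) κ₁ κ₂ (-Complex.I * z) (u α)
      + K * ∑ k ∈ Finset.Icc (α + 1) β,
          accrual τ k * hFun φ ψ (τ (N + 1)) (τ α) κ₁ κ₂ (-Complex.I * z) (u k))

end Formulas

end AffineLibor

end

/-! Under `Q^T`, every claim in question has price `P(t,T) E[f(X_s) | F_t]`, where `f` is a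
combination of functions `M^{u_j}` cut off at two points at which it vanishes. This `f` is
continuous with compact support, so Fourier inversion and Fubini turn the expectation into the
stated integral.

Reduction to `f`: by the Markov property the bond ratios are `M_t^{u_k}(X_t)`, which are
martingales. The density of a forward measure is therefore a constant multiple of `M^{u_k}` at time
`T_k`, and the Bayes formula moves the price to `Q^T` (`price_eq`). Payoffs become `(g(X_s))_+`,
with `g` built from quotients of the `M^{u_j}`.

Shape of `g`: up to sign, constants and inversion, `g` is a quotient of `M^v` by a nonnegative
combination of `M^{u_j}` with `u_j < v`. Both are exponential sums. If `ψ` is strictly increasing,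
the exponents in the numerator strictly enclose those in the denominator. The derivative is then a
positive factor times a strictly increasing function, and the quotient tends to infinity at both
ends, so it first falls and then rises (`exists_strictAntiOn_strictMonoOn`). This makes `g` unimodal
and determines the two cut-off points.

Monotonicity of `ψ_t` (`IsExponentPair.strictMonoOn`): on the half-line it is weakly increasing by
comparison of exponentials; on the line, log-convexity for all starting points makes it linear. If
injectivity failed, `ψ_t` would vanish near `0` by analyticity. By the flow property so would
`ψ_{t/2^n}`, and the laws started in `0` and `1` would coincide at arbitrarily small times, against
stochastic continuity. The flow property also excludes a negative slope on the line.

Fourier side: since `f` vanishes at the cut-offs, integration by parts leaves no boundary terms.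
This gives the closed form through `hFun` and decay of order `y⁻²` on each horizontal line, hence
absolute convergence. -/

noncomputable section

namespace AffineLibor

/-! ### Additive functions on a half-line or on the line -/

/-- A measurable additive function on a subset of `ℝ` that is `[0, ∞)` or `ℝ` is linear. -/
lemma eq_mul_of_measurable_additive {D : Set ℝ} (hD : D = Ici 0 ∨ D = univ) {L : D → ℝ}
    (hL : Measurable L) (hadd : ∀ x y z : D, (z : ℝ) = x + y → L z = L x + L y) :
    ∃ c : ℝ, ∀ x : D, L x = c * x := by
  have hsub : ∀ x : ℝ, 0 ≤ x → x ∈ D := by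
    rcases hD with rfl | rfl
    · exact fun x hx => hx
    · exact fun x _ => mem_univ x
  let p : ℝ → D := fun x => ⟨max x 0, hsub _ (le_max_right _ _)⟩
  have hp : Measurable p := (measurable_id.max measurable_const).subtype_mk
  have hsum : ∀ a b c d : D, (a : ℝ) + b = c + d → 0 ≤ (a : ℝ) → 0 ≤ (b : ℝ) →
      L a + L b = L c + L d := by
    intro a b c d h ha hb
    have hm : (a : ℝ) + b ∈ D := hsub _ (by positivity)
    rw [← hadd a b ⟨_, hm⟩ rfl, ← hadd c d ⟨_, hm⟩ h]
  -- `L(x⁺) - L(x⁻)` extends `L` from the half-line to an additive map on all of `ℝ`, where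
  -- measurability forces continuity and hence linearity.
  let G : ℝ →+ ℝ := AddMonoidHom.mk' (fun x => L (p x) - L (p (-x))) (by
    intro x y
    have hs : ∀ a : ℝ, (p a : ℝ) = p (-a) + a := by
      intro a
      rcases le_total a 0 with h | h <;> simp [p, h]
    have h1 : ∀ a b : ℝ, L (p a) + L (p b) =
        L ⟨(p a : ℝ) + p b, hsub _ (add_nonneg (le_max_right _ _) (le_max_right _ _))⟩ :=
      fun a b => (hadd _ _ _ rfl).symm
    have h2 : ∀ a b c : ℝ, L (p a) + L (p b) + L (p c) =
        L ⟨(p a : ℝ) + p b + p c, hsub _ (add_nonneg (add_nonneg (le_max_right _ _)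
          (le_max_right _ _)) (le_max_right _ _))⟩ := by
      intro a b c
      rw [h1]
      exact (hadd _ _ _ rfl).symm
    have h3 : L (p (x + y)) + L (p (-x)) + L (p (-y))
        = L (p x) + L (p y) + L (p (-(x + y))) := by
      rw [h2, h2]
      congr 2
      rw [hs (x + y), hs x, hs y]
      ring
    change L (p (x + y)) - L (p (-(x + y)))
      = L (p x) - L (p (-x)) + (L (p y) - L (p (-y)))
    linarith)
  have hG : Continuous G := Measure.AddMonoidHom.continuous_of_measurable G
    ((hL.comp hp).sub (hL.comp (hp.comp measurable_neg)))
  have hGlin : ∀ x : ℝ, G x = G 1 * x := by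
    intro x
    have := map_real_smul G hG x 1
    simp only [smul_eq_mul, mul_one] at this
    rw [this, mul_comm]
  have h0 : ∀ z : D, (z : ℝ) = 0 → L z = 0 := by
    intro z hz
    have := hadd z z z (by simp [hz])
    linarith
  refine ⟨G 1, fun x => ?_⟩
  rw [← hGlin]
  change L x = L (p x) - L (p (-x))
  rcases le_total (0 : ℝ) x with hx | hx
  · rw [h0 (p (-x)) (by simp [p, hx]), sub_zero]
    congr 1
    exact Subtype.ext (by simp [p, hx])
  · rw [h0 (p x) (by simp [p, hx])]
    have := hadd x (p (-x)) (p x) (by simp [p, hx])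
    rw [h0 (p x) (by simp [p, hx])] at this
    linarith

/-! ### Moment generating functions -/

lemma mgf_id_conv (μ ν : Measure ℝ) [SFinite μ] [SFinite ν] (v : ℝ) :
    mgf id (μ ∗ ν) v = mgf id μ v * mgf id ν v := by
  simp only [mgf, id]
  rw [Measure.conv, integral_map (by fun_prop) (by fun_prop), ← integral_prod_mul]
  simp [mul_add, Real.exp_add]

section

variable {Ω : Type*} {mΩ : MeasurableSpace Ω}

/-- Products of characteristic functions belong to convolutions, so the hypothesis identifies two
convolutions, and their real moment generating functions agree. This carries the affine property
from the imaginary axis to real arguments without analytic continuation or integrability conditions.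
-/
lemma mgf_mul_mgf_eq_of_charFun {X : Ω → ℝ} (hX : Measurable X) {μ₁ μ₂ μ₃ μ₄ : Measure Ω}
    [IsProbabilityMeasure μ₁] [IsProbabilityMeasure μ₂] [IsProbabilityMeasure μ₃]
    [IsProbabilityMeasure μ₄]
    (h : ∀ y : ℝ, complexMGF X μ₁ (y * Complex.I) * complexMGF X μ₂ (y * Complex.I)
      = complexMGF X μ₃ (y * Complex.I) * complexMGF X μ₄ (y * Complex.I)) (v : ℝ) :
    mgf X μ₁ v * mgf X μ₂ v = mgf X μ₃ v * mgf X μ₄ v := by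
  have i₁ := Measure.isProbabilityMeasure_map (μ := μ₁) hX.aemeasurable
  have i₂ := Measure.isProbabilityMeasure_map (μ := μ₂) hX.aemeasurable
  have i₃ := Measure.isProbabilityMeasure_map (μ := μ₃) hX.aemeasurable
  have i₄ := Measure.isProbabilityMeasure_map (μ := μ₄) hX.aemeasurable
  have hconv : μ₁.map X ∗ μ₂.map X = μ₃.map X ∗ μ₄.map X := by
    apply Measure.ext_of_charFun
    ext y
    simpa only [charFun_conv, complexMGF_mul_I hX.aemeasurable] using h y
  have := congrArg (fun ν => mgf id ν v) hconv
  simpa only [mgf_id_conv, mgf_id_map hX.aemeasurable] using this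

end

/-! ### The exponentially affine form at real arguments -/

section Affine

variable {Ω : Type*} {mΩ : MeasurableSpace Ω} {D : Set ℝ} {𝓕 : Filtration ℝ≥0 mΩ}
  {X : ℝ≥0 → Ω → D} {P : Kernel D Ω} {T : ℝ≥0}

lemma IsHomogeneousMarkov.measurable (h : IsHomogeneousMarkov 𝓕 X P T) {t : ℝ≥0} (ht : t ≤ T) :
    Measurable (X t) :=
  (h.adapted t ht).mono (𝓕.le t) le_rfl

lemma IsHomogeneousMarkov.measurable_coe (h : IsHomogeneousMarkov 𝓕 X P T) {t : ℝ≥0}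
    (ht : t ≤ T) : Measurable fun ω => (X t ω : ℝ) :=
  measurable_subtype_coe.comp (h.measurable ht)

lemma integrable_exp_of_mem_momentSet (h : IsHomogeneousMarkov 𝓕 X P T) {t : ℝ≥0} (ht : t ≤ T)
    {z : ℂ} (hz : z ∈ momentSet X P T) (x : D) :
    Integrable (fun ω => Real.exp (z.re * (X t ω : ℝ))) (P x) := by
  have hm := h.measurable_coe ht
  refine ⟨(Real.measurable_exp.comp (hm.const_mul z.re)).aestronglyMeasurable, ?_⟩
  rw [hasFiniteIntegral_iff_ofReal (ae_of_all _ fun _ => (Real.exp_pos _).le)]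
  exact (le_iSup₂ (f := fun s (_ : s ∈ Iic T) =>
    ∫⁻ ω, ENNReal.ofReal (Real.exp (z.re * (X s ω : ℝ))) ∂(P x)) t ht).trans_lt (hz x)

lemma integrable_real_exp (h : IsHomogeneousMarkov 𝓕 X P T) {t : ℝ≥0} (ht : t ≤ T)
    {v : ℝ} (hv : (v : ℂ) ∈ momentSet X P T) (x : D) :
    Integrable (fun ω => Real.exp (v * (X t ω : ℝ))) (P x) := by
  simpa using integrable_exp_of_mem_momentSet h ht hv x

lemma zero_mem_momentSet [IsMarkovKernel P] : (0 : ℂ) ∈ momentSet X P T := by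
  intro x
  refine lt_of_le_of_lt (iSup₂_le (a := 1) fun s _ => ?_) ENNReal.one_lt_top
  simp

lemma IsAnalyticAffine.nonneg_mem (hX : IsAnalyticAffine 𝓕 X P T) {x : ℝ} (hx : 0 ≤ x) :
    x ∈ D := by
  rcases hX.stateSpace with rfl | rfl
  · exact hx
  · exact mem_univ x

/-- The product of the characteristic functions started in `a` and `b` depends only on `a + b`. With
`d = 0` this is the additivity in the starting point of the logarithm of the moment generating
function, normalized at `0`. -/
lemma IsAnalyticAffine.mgf_mul_mgf [IsMarkovKernel P] (hX : IsAnalyticAffine 𝓕 X P T) {t : ℝ≥0}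
    (ht : t ≤ T) (a b c d : D) (habcd : (a : ℝ) + b = c + d) (v : ℝ) :
    mgf (fun ω => (X t ω : ℝ)) (P a) v * mgf (fun ω => (X t ω : ℝ)) (P b) v
      = mgf (fun ω => (X t ω : ℝ)) (P c) v * mgf (fun ω => (X t ω : ℝ)) (P d) v := by
  obtain ⟨φ, ψ, hφψ⟩ := hX.affine
  refine mgf_mul_mgf_eq_of_charFun (hX.isMarkov.measurable_coe ht) (fun y => ?_) v
  have hc : ∀ x : D, complexMGF (fun ω => (X t ω : ℝ)) (P x) (y * Complex.I)
      = Complex.exp (φ t (y * Complex.I) + ψ t (y * Complex.I) * ((x : ℝ) : ℂ)) :=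
    fun x => hφψ t ht (y * Complex.I) (by simp) x
  rw [hc, hc, hc, hc, ← Complex.exp_add, ← Complex.exp_add]
  congr 1
  have : ((a : ℝ) : ℂ) + ((b : ℝ) : ℂ) = ((c : ℝ) : ℂ) + ((d : ℝ) : ℂ) := by
    exact_mod_cast habcd
  linear_combination ψ t (y * Complex.I) * this

lemma mgf_pos_of_mem [IsMarkovKernel P] (h : IsHomogeneousMarkov 𝓕 X P T) {t : ℝ≥0} (ht : t ≤ T)
    {v : ℝ} (hv : (v : ℂ) ∈ momentSet X P T) (x : D) :
    0 < mgf (fun ω => (X t ω : ℝ)) (P x) v :=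
  mgf_pos (integrable_real_exp h ht hv x)

lemma IsAnalyticAffine.exists_mgf_eq_exp [IsMarkovKernel P] (hX : IsAnalyticAffine 𝓕 X P T)
    {t : ℝ≥0} (ht : t ≤ T) {v : ℝ} (hv : (v : ℂ) ∈ momentSet X P T) :
    ∃ a b : ℝ, ∀ x : D, mgf (fun ω => (X t ω : ℝ)) (P x) v = Real.exp (a + b * x) := by
  have h0 : (0 : ℝ) ∈ D := hX.nonneg_mem le_rfl
  set F : D → ℝ := fun x => mgf (fun ω => (X t ω : ℝ)) (P x) v with hF
  have hpos : ∀ x, 0 < F x := mgf_pos_of_mem hX.isMarkov ht hv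
  have hm := hX.isMarkov.measurable_coe ht
  have hFm : Measurable F := by
    have : StronglyMeasurable fun ω => Real.exp (v * (X t ω : ℝ)) :=
      (Real.measurable_exp.comp (hm.const_mul v)).stronglyMeasurable
    exact this.integral_kernel.measurable
  obtain ⟨c, hc⟩ := eq_mul_of_measurable_additive hX.stateSpace
    (L := fun x => Real.log (F x) - Real.log (F ⟨0, h0⟩))
    ((Real.measurable_log.comp hFm).sub_const _) (by
      intro x y z hz
      have := hX.mgf_mul_mgf ht x y z ⟨0, h0⟩ (by simp [hz]) v
      change F x * F y = F z * F ⟨0, h0⟩ at this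
      have h2 := congrArg Real.log this
      rw [Real.log_mul (hpos _).ne' (hpos _).ne', Real.log_mul (hpos _).ne' (hpos _).ne'] at h2
      linarith)
  refine ⟨Real.log (F ⟨0, h0⟩), c, fun x => ?_⟩
  rw [← hc x, add_sub_cancel, Real.exp_log (hpos x)]

lemma IsAnalyticAffine.exists_isExponentPair [IsMarkovKernel P] (hX : IsAnalyticAffine 𝓕 X P T) :
    ∃ φ ψ : ℝ≥0 → ℝ → ℝ, IsExponentPair X P T φ ψ := by
  classical
  have h : ∀ t : ℝ≥0, ∀ v : ℝ, ∃ ab : ℝ × ℝ, t ≤ T → (v : ℂ) ∈ momentSet X P T → ∀ x : D,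
      ∫ ω, Real.exp (v * (X t ω : ℝ)) ∂(P x) = Real.exp (ab.1 + ab.2 * (x : ℝ)) := by
    intro t v
    by_cases htv : t ≤ T ∧ (v : ℂ) ∈ momentSet X P T
    · obtain ⟨a, b, hab⟩ := hX.exists_mgf_eq_exp htv.1 htv.2
      exact ⟨(a, b), fun _ _ => hab⟩
    · exact ⟨0, fun h1 h2 => absurd ⟨h1, h2⟩ htv⟩
  choose f hf using h
  exact ⟨fun t v => (f t v).1, fun t v => (f t v).2, fun t ht v hv x => hf t v ht hv x⟩

end Affine

/-! ### The Markov property for functions -/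

section Markov

variable {Ω : Type*} {mΩ : MeasurableSpace Ω} {D : Set ℝ} {𝓕 : Filtration ℝ≥0 mΩ}
  {X : ℝ≥0 → Ω → D} {P : Kernel D Ω} [IsMarkovKernel P] {T : ℝ≥0}
  {E : Type*} [NormedAddCommGroup E] [NormedSpace ℝ E] [CompleteSpace E]

/-- The Markov property for sets, integrated over an event `G` of the past, is an identity between
measures. In this form it passes to integrable functions by integrating against a composition of a
measure and a kernel, with no approximation by simple functions. -/
lemma IsHomogeneousMarkov.map_restrict (hX : IsHomogeneousMarkov 𝓕 X P T) (x : D) {s h : ℝ≥0}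
    (hsh : s + h ≤ T) {G : Set Ω} (hG : MeasurableSet[𝓕 s] G) :
    ((P x).restrict G).map (X (s + h)) = (P.map (X h)) ∘ₘ ((P x).restrict G).map (X s) := by
  have hms : Measurable (X s) := hX.measurable (le_self_add.trans hsh)
  have hmh : Measurable (X h) := hX.measurable (le_add_self.trans hsh)
  have hm := hX.measurable hsh
  ext A hA
  have hK : Measurable fun y : D => P y (X h ⁻¹' A) := Kernel.measurable_coe P (hmh hA)
  rw [Measure.map_apply hm hA, Measure.restrict_apply (hm hA), Measure.bind_apply hA
    (Kernel.aemeasurable _)]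
  simp_rw [Kernel.map_apply' _ hmh _ hA]
  rw [lintegral_map hK hms]
  have h1 := hX.markov x s h hsh A hA
  have hint : Integrable ((X (s + h) ⁻¹' A).indicator fun _ => (1 : ℝ)) (P x) :=
    (integrable_const _).indicator (hm hA)
  have h2 := setIntegral_condExp (𝓕.le s) hint hG
  rw [setIntegral_congr_ae (𝓕.le s _ hG) (h1.mono fun _ h _ => h),
    integral_indicator_const _ (hm hA), measureReal_restrict_apply (hm hA), smul_eq_mul,
    mul_one] at h2
  have h3 : ∫ ω in G, (P (X s ω)).real (X h ⁻¹' A) ∂(P x)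
      = (∫⁻ ω in G, P (X s ω) (X h ⁻¹' A) ∂(P x)).toReal :=
    integral_toReal (hK.comp hms).aemeasurable (ae_of_all _ fun _ => measure_lt_top _ _)
  rw [h3, measureReal_def, ENNReal.toReal_eq_toReal_iff' _ (measure_ne_top _ _)] at h2
  · exact h2.symm
  · refine ((lintegral_mono (g := fun _ => 1) fun _ => prob_le_one).trans_lt ?_).ne
    simp

lemma IsHomogeneousMarkov.condExp_comp (hX : IsHomogeneousMarkov 𝓕 X P T) (x : D) {s h : ℝ≥0}
    (hsh : s + h ≤ T) {f : D → E} (hf : StronglyMeasurable f)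
    (hint : Integrable (fun ω => f (X (s + h) ω)) (P x)) :
    (P x)[fun ω => f (X (s + h) ω) | 𝓕 s]
      =ᵐ[P x] fun ω => ∫ ω', f (X h ω') ∂(P (X s ω)) := by
  have hsT : s ≤ T := le_self_add.trans hsh
  have hms : Measurable (X s) := hX.measurable hsT
  have hmh : Measurable (X h) := hX.measurable (le_add_self.trans hsh)
  have hm := hX.measurable hsh
  have hfm : ∀ y : D, ∫ z, f z ∂((P.map (X h)) y) = ∫ ω', f (X h ω') ∂(P y) := by
    intro y
    rw [Kernel.map_apply _ hmh, integral_map hmh.aemeasurable hf.aestronglyMeasurable]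
  have hI : StronglyMeasurable fun y : D => ∫ ω', f (X h ω') ∂(P y) :=
    (hf.comp_measurable hmh).integral_kernel
  have key : ∀ G, MeasurableSet[𝓕 s] G →
      Integrable f ((P.map (X h)) ∘ₘ ((P x).restrict G).map (X s)) := by
    intro G hG
    rw [← hX.map_restrict x hsh hG, integrable_map_measure hf.aestronglyMeasurable hm.aemeasurable]
    exact hint.integrableOn
  have hMk : IsMarkovKernel (P.map (X h)) := Kernel.IsMarkovKernel.map P hmh
  symm
  refine ae_eq_condExp_of_forall_setIntegral_eq (𝓕.le s) hint (fun G hG _ => ?_)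
    (fun G hG _ => ?_) ?_
  · have := key G hG
    rw [Measure.comp_eq_comp_const_apply] at this
    have := this.integral_comp
    simp only [Kernel.const_apply, hfm] at this
    exact (integrable_map_measure hI.aestronglyMeasurable hms.aemeasurable).1 this
  · have h1 := key G hG
    rw [Measure.comp_eq_comp_const_apply] at h1
    have h2 := Kernel.integral_comp h1
    rw [← Measure.comp_eq_comp_const_apply, ← hX.map_restrict x hsh hG,
      integral_map hm.aemeasurable hf.aestronglyMeasurable] at h2
    simp only [Kernel.const_apply, hfm] at h2
    rw [h2, integral_map hms.aemeasurable hI.aestronglyMeasurable]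
  · exact (hI.comp_measurable (hX.adapted s hsT)).aestronglyMeasurable

lemma IsHomogeneousMarkov.condExp_comp_of_le (hX : IsHomogeneousMarkov 𝓕 X P T) (x : D)
    {s t : ℝ≥0} (hst : s ≤ t) (htT : t ≤ T) {f : D → E} (hf : StronglyMeasurable f)
    (hint : Integrable (fun ω => f (X t ω)) (P x)) :
    (P x)[fun ω => f (X t ω) | 𝓕 s]
      =ᵐ[P x] fun ω => ∫ ω', f (X (t - s) ω') ∂(P (X s ω)) := by
  obtain ⟨h, rfl⟩ := exists_add_of_le hst
  rw [add_tsub_cancel_left]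
  exact hX.condExp_comp x htT hf hint

lemma condExp_exp (hX : IsHomogeneousMarkov 𝓕 X P T) (x : D) {s t : ℝ≥0} (hst : s ≤ t)
    (htT : t ≤ T) {z : ℂ} (hz : z ∈ momentSet X P T) :
    (P x)[fun ω => Complex.exp (z * ((X t ω : ℝ) : ℂ)) | 𝓕 s]
      =ᵐ[P x] fun ω => mgfFrom X P (t - s) z (X s ω) := by
  have hc : Continuous fun y : D => Complex.exp (z * ((y : ℝ) : ℂ)) := by fun_prop
  refine hX.condExp_comp_of_le x hst htT (f := fun y : D => Complex.exp (z * ((y : ℝ) : ℂ)))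
    hc.stronglyMeasurable ?_
  refine (integrable_exp_of_mem_momentSet hX htT hz x).mono'
    (hc.measurable.comp (hX.measurable htT)).aestronglyMeasurable (ae_of_all _ fun ω => ?_)
  simp [Complex.norm_exp]

/-- The semigroup property: `E^x[f(X_{s+h})] = E^x[E^{X_s}[f(X_h)]]`. -/
lemma IsHomogeneousMarkov.integral_comp_add (hX : IsHomogeneousMarkov 𝓕 X P T) (x : D)
    {s h : ℝ≥0} (hsh : s + h ≤ T) {f : D → E} (hf : StronglyMeasurable f)
    (hint : Integrable (fun ω => f (X (s + h) ω)) (P x)) :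
    ∫ ω, f (X (s + h) ω) ∂(P x) = ∫ ω, ∫ ω', f (X h ω') ∂(P (X s ω)) ∂(P x) := by
  rw [← integral_congr_ae (hX.condExp_comp x hsh hf hint), integral_condExp (𝓕.le s)]

lemma integral_comp_zero (hX : IsHomogeneousMarkov 𝓕 X P T) (x : D) (f : D → E) :
    ∫ ω, f (X 0 ω) ∂(P x) = f x := by
  rw [integral_congr_ae (g := fun _ => f x) ((hX.initial x).mono fun ω h => by simp only [h])]
  simp

end Markov

/-! ### Strict monotonicity of the exponent `ψ` -/

lemma le_of_forall_add_mul_le {a b c d : ℝ} (h : ∀ x : ℝ, 0 ≤ x → a + b * x ≤ c + d * x) :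
    b ≤ d := by
  by_contra! hdb
  have hpos : 0 < b - d := sub_pos.2 hdb
  have := h ((|c - a| + 1) / (b - d)) (by positivity)
  have h2 : (b - d) * ((|c - a| + 1) / (b - d)) = |c - a| + 1 := by field_simp
  have := le_abs_self (c - a)
  nlinarith

/-- The complex moment generating functions are analytic on the strip over `S` and agree at real
points accumulating at `0`. By the identity theorem they agree on the imaginary axis, which
determines the law. -/
lemma map_eq_map_of_mgf_eqOn {Ω : Type*} {mΩ : MeasurableSpace Ω} {Y : Ω → ℝ} (hY : Measurable Y)
    {μ ν : Measure Ω} [IsFiniteMeasure μ] [IsFiniteMeasure ν] {S : Set ℝ} (hS : IsOpen S)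
    (hSc : Convex ℝ S) (h0 : (0 : ℝ) ∈ S) (hμ : S ⊆ integrableExpSet Y μ)
    (hν : S ⊆ integrableExpSet Y ν) (h : EqOn (mgf Y μ) (mgf Y ν) S) :
    μ.map Y = ν.map Y := by
  have hμ' : AnalyticOnNhd ℂ (complexMGF Y μ) {z | z.re ∈ S} :=
    analyticOnNhd_complexMGF.mono fun z hz => interior_maximal hμ hS hz
  have hν' : AnalyticOnNhd ℂ (complexMGF Y ν) {z | z.re ∈ S} :=
    analyticOnNhd_complexMGF.mono fun z hz => interior_maximal hν hS hz
  have key : EqOn (complexMGF Y μ) (complexMGF Y ν) {z | z.re ∈ S} := by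
    refine hμ'.eqOn_of_preconnected_of_frequently_eq hν'
      (hSc.linear_preimage Complex.reLm).isPreconnected (z₀ := ((0 : ℝ) : ℂ)) (by simpa using h0) ?_
    have hreal : ∃ᶠ x : ℝ in 𝓝[≠] 0, complexMGF Y μ x = complexMGF Y ν x := by
      refine Eventually.frequently ?_
      filter_upwards [nhdsWithin_le_nhds (hS.mem_nhds h0)] with x hx
      rw [complexMGF_ofReal, complexMGF_ofReal, h hx]
    rw [frequently_iff_seq_forall] at hreal ⊢
    obtain ⟨xs, hx, hxe⟩ := hreal
    refine ⟨fun n => xs n, ?_, fun n => hxe n⟩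
    rw [tendsto_nhdsWithin_iff] at hx ⊢
    refine ⟨(Complex.continuous_ofReal.tendsto 0).comp hx.1, ?_⟩
    simpa using hx.2
  have := Measure.isFiniteMeasure_map μ Y
  have := Measure.isFiniteMeasure_map ν Y
  apply Measure.ext_of_charFun
  ext y
  rw [← complexMGF_mul_I hY.aemeasurable, ← complexMGF_mul_I hY.aemeasurable]
  exact key (by simpa using h0)

/-- Convexity of the cumulant generating function. -/
lemma le_of_integral_exp_eq {Ω : Type*} {mΩ : MeasurableSpace Ω} {Y : Ω → ℝ} {μ : Measure Ω}
    {v w a b l m n : ℝ} (iv : Integrable (fun ω => Real.exp (v * Y ω)) μ)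
    (iw : Integrable (fun ω => Real.exp (w * Y ω)) μ)
    (im : Integrable (fun ω => Real.exp ((a * v + b * w) * Y ω)) μ)
    (ha : 0 ≤ a) (hb : 0 ≤ b) (hab : a + b = 1)
    (hl : ∫ ω, Real.exp (v * Y ω) ∂μ = Real.exp l) (hm : ∫ ω, Real.exp (w * Y ω) ∂μ = Real.exp m)
    (hn : ∫ ω, Real.exp ((a * v + b * w) * Y ω) ∂μ = Real.exp n) : n ≤ a * l + b * m := by
  -- Normalizing the two exponentials to have integral `1` lets the pointwise convexity of `exp`
  -- replace Hölder's inequality: the right side integrates to `a + b = 1`.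
  have hle : ∫ ω, Real.exp (-(a * l + b * m)) * Real.exp ((a * v + b * w) * Y ω) ∂μ
      ≤ ∫ ω, (a * Real.exp (-l) * Real.exp (v * Y ω)
        + b * Real.exp (-m) * Real.exp (w * Y ω)) ∂μ := by
    refine integral_mono (im.const_mul _) ((iv.const_mul _).add (iw.const_mul _)) fun ω => ?_
    have := convexOn_exp.2 (mem_univ (v * Y ω - l)) (mem_univ (w * Y ω - m)) ha hb hab
    simp only [smul_eq_mul] at this
    have e1 : Real.exp (-(a * l + b * m)) * Real.exp ((a * v + b * w) * Y ω)
        = Real.exp (a * (v * Y ω - l) + b * (w * Y ω - m)) := by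
      rw [← Real.exp_add]; congr 1; ring
    have e2 : ∀ c d : ℝ, Real.exp (d - c) = Real.exp (-c) * Real.exp d := fun c d => by
      rw [← Real.exp_add]; congr 1; ring
    rw [e2, e2, ← e1] at this
    linarith
  rw [integral_add (iv.const_mul _) (iw.const_mul _), integral_const_mul, integral_const_mul,
    integral_const_mul, hl, hm, hn, mul_assoc, mul_assoc, ← Real.exp_add, ← Real.exp_add,
    ← Real.exp_add, neg_add_cancel, neg_add_cancel, Real.exp_zero, mul_one, mul_one, hab] at hle
  have := Real.exp_le_one_iff.1 hle
  linarith

/-! ### The exponent `ψ` on the real moment set -/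

section Affine

variable {Ω : Type*} {mΩ : MeasurableSpace Ω} {D : Set ℝ} {𝓕 : Filtration ℝ≥0 mΩ}
  {X : ℝ≥0 → Ω → D} {P : Kernel D Ω} {T : ℝ≥0}

/-- The real points of `𝒱`. -/
def realMomentSet (X : ℝ≥0 → Ω → D) (P : Kernel D Ω) (T : ℝ≥0) : Set ℝ :=
  {v | (v : ℂ) ∈ momentSet X P T}

lemma realMomentSet_subset (h : IsHomogeneousMarkov 𝓕 X P T) {t : ℝ≥0} (ht : t ≤ T) (x : D) :
    realMomentSet X P T ⊆ integrableExpSet (fun ω => (X t ω : ℝ)) (P x) :=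
  fun _ hv => integrable_real_exp h ht hv x

/-- For `v ≤ z ≤ w` one has `e^{zx} ≤ e^{vx} + e^{wx}` for every real `x`, whatever its sign. -/
lemma ordConnected_realMomentSet (h : IsHomogeneousMarkov 𝓕 X P T) :
    OrdConnected (realMomentSet X P T) := by
  refine ⟨fun v hv w hw z hz x => ?_⟩
  refine lt_of_le_of_lt (iSup₂_le fun s hs => ?_) (ENNReal.add_lt_top.2 ⟨hv x, hw x⟩)
  have hm : Measurable fun ω => (X s ω : ℝ) := h.measurable_coe hs
  refine le_trans ?_ (add_le_add
    (le_iSup₂ (f := fun s (_ : s ∈ Iic T) =>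
      ∫⁻ ω, ENNReal.ofReal (Real.exp ((v : ℂ).re * (X s ω : ℝ))) ∂(P x)) s hs)
    (le_iSup₂ (f := fun s (_ : s ∈ Iic T) =>
      ∫⁻ ω, ENNReal.ofReal (Real.exp ((w : ℂ).re * (X s ω : ℝ))) ∂(P x)) s hs))
  simp only [Complex.ofReal_re]
  have hmv : Measurable fun ω => ENNReal.ofReal (Real.exp (v * (X s ω : ℝ))) :=
    (Real.measurable_exp.comp (hm.const_mul v)).ennreal_ofReal
  rw [← lintegral_add_left hmv]
  refine lintegral_mono fun ω => ?_
  rw [← ENNReal.ofReal_add (Real.exp_pos _).le (Real.exp_pos _).le]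
  refine ENNReal.ofReal_le_ofReal ?_
  rcases le_total 0 (X s ω : ℝ) with hx | hx
  · exact (Real.exp_le_exp.2 (mul_le_mul_of_nonneg_right hz.2 hx)).trans
      (le_add_of_nonneg_left (Real.exp_pos _).le)
  · exact (Real.exp_le_exp.2 (mul_le_mul_of_nonpos_right hz.1 hx)).trans
      (le_add_of_nonneg_right (Real.exp_pos _).le)

lemma IsAnalyticAffine.zero_mem_interior (hX : IsAnalyticAffine 𝓕 X P T) :
    (0 : ℝ) ∈ interior (realMomentSet X P T) :=
  preimage_interior_subset_interior_preimage Complex.continuous_ofReal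
    (by simpa using hX.zero_mem)

lemma convex_interior_realMomentSet (h : IsHomogeneousMarkov 𝓕 X P T) :
    Convex ℝ (interior (realMomentSet X P T)) :=
  (ordConnected_realMomentSet h).convex.interior

variable {φ ψ : ℝ≥0 → ℝ → ℝ}

lemma IsExponentPair.mgf_eq (hφψ : IsExponentPair X P T φ ψ) {t : ℝ≥0} (ht : t ≤ T) {v : ℝ}
    (hv : v ∈ realMomentSet X P T) (x : D) :
    mgf (fun ω => (X t ω : ℝ)) (P x) v = Real.exp (φ t v + ψ t v * x) :=
  hφψ t ht v hv x

/-- Two exponentially affine functions that agree on `D` have the same coefficients. -/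
lemma IsAnalyticAffine.coeff_ext (hX : IsAnalyticAffine 𝓕 X P T) {a b c d : ℝ}
    (h : ∀ x : D, Real.exp (a + b * x) = Real.exp (c + d * x)) : a = c ∧ b = d := by
  have h0 := Real.exp_injective (h ⟨0, hX.nonneg_mem le_rfl⟩)
  have h1 := Real.exp_injective (h ⟨1, hX.nonneg_mem zero_le_one⟩)
  simp only [mul_zero, add_zero, mul_one] at h0 h1
  exact ⟨h0, by linarith⟩

/-- For a nonnegative process, `v ≤ w` gives `e^{vX} ≤ e^{wX}`; comparing the affine exponents for
large starting points orders the slopes. -/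
lemma IsExponentPair.monotoneOn_of_Ici (hφψ : IsExponentPair X P T φ ψ)
    (hX : IsAnalyticAffine 𝓕 X P T) (hD : D = Ici 0) {t : ℝ≥0} (ht : t ≤ T) :
    MonotoneOn (ψ t) (realMomentSet X P T) := by
  intro v hv w hw hvw
  refine le_of_forall_add_mul_le (a := φ t v) (c := φ t w) fun x hx => ?_
  have hxD := hX.nonneg_mem hx
  rw [← Real.exp_le_exp, ← hφψ t ht v hv ⟨x, hxD⟩, ← hφψ t ht w hw ⟨x, hxD⟩]
  refine integral_mono (integrable_real_exp hX.isMarkov ht hv _)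
    (integrable_real_exp hX.isMarkov ht hw _) fun ω => ?_
  refine Real.exp_le_exp.2 (mul_le_mul_of_nonneg_right hvw ?_)
  exact hD.le (X t ω).2

/-- For each starting point `x`, the function `v ↦ φ_t(v) + ψ_t(v) x` is convex. When `x` may go to
both `+∞` and `-∞`, the slopes in `x` satisfy both inequalities, so `ψ_t` is affine. -/
lemma IsExponentPair.affine_of_univ (hφψ : IsExponentPair X P T φ ψ)
    (hX : IsAnalyticAffine 𝓕 X P T) (hD : D = univ) {t : ℝ≥0} (ht : t ≤ T) {v w a b : ℝ}
    (hv : v ∈ realMomentSet X P T) (hw : w ∈ realMomentSet X P T) (ha : 0 ≤ a) (hb : 0 ≤ b)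
    (hab : a + b = 1) : ψ t (a * v + b * w) = a * ψ t v + b * ψ t w := by
  have hmem : a * v + b * w ∈ realMomentSet X P T := by
    have hconv : Convex ℝ (realMomentSet X P T) := (ordConnected_realMomentSet hX.isMarkov).convex
    simpa only [smul_eq_mul] using hconv hv hw ha hb hab
  have key : ∀ x : ℝ, φ t (a * v + b * w) + ψ t (a * v + b * w) * x
      ≤ (a * φ t v + b * φ t w) + (a * ψ t v + b * ψ t w) * x := by
    intro x
    have hxD : x ∈ D := hD ▸ mem_univ x
    have := le_of_integral_exp_eq (integrable_real_exp hX.isMarkov ht hv ⟨x, hxD⟩)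
      (integrable_real_exp hX.isMarkov ht hw ⟨x, hxD⟩)
      (integrable_real_exp hX.isMarkov ht hmem ⟨x, hxD⟩) ha hb hab
      (hφψ t ht v hv _) (hφψ t ht w hw _) (hφψ t ht _ hmem _)
    linarith
  refine le_antisymm (le_of_forall_add_mul_le fun x _ => key x) ?_
  refine neg_le_neg_iff.1 (le_of_forall_add_mul_le (a := φ t (a * v + b * w))
    (c := a * φ t v + b * φ t w) fun x _ => ?_)
  have := key (-x)
  linarith

variable [IsMarkovKernel P]

lemma IsExponentPair.apply_zero (hφψ : IsExponentPair X P T φ ψ) (hX : IsAnalyticAffine 𝓕 X P T)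
    {t : ℝ≥0} (ht : t ≤ T) : φ t 0 = 0 ∧ ψ t 0 = 0 :=
  hX.coeff_ext fun x => by
    rw [← hφψ.mgf_eq ht (interior_subset hX.zero_mem_interior) x, mgf_zero]
    simp

lemma IsExponentPair.time_zero (hφψ : IsExponentPair X P T φ ψ) (hX : IsAnalyticAffine 𝓕 X P T)
    {v : ℝ} (hv : v ∈ realMomentSet X P T) : φ 0 v = 0 ∧ ψ 0 v = v :=
  hX.coeff_ext fun x => by
    rw [← hφψ 0 zero_le v hv x, integral_comp_zero hX.isMarkov x fun y : D => Real.exp (v * y)]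
    simp

/-- The flow property of `ψ`. -/
lemma IsExponentPair.flow (hφψ : IsExponentPair X P T φ ψ) (hX : IsAnalyticAffine 𝓕 X P T)
    {s h : ℝ≥0} (hsh : s + h ≤ T) {v : ℝ} (hv : v ∈ realMomentSet X P T)
    (hψv : ψ h v ∈ realMomentSet X P T) : ψ (s + h) v = ψ s (ψ h v) := by
  have hc : Continuous fun y : D => Real.exp (v * y) := by fun_prop
  refine (hX.coeff_ext (a := φ (s + h) v) (c := φ h v + φ s (ψ h v)) fun x => ?_).2
  rw [← hφψ _ hsh v hv x, hX.isMarkov.integral_comp_add x hsh (f := fun y : D => Real.exp (v * y))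
    hc.stronglyMeasurable (integrable_real_exp hX.isMarkov hsh hv x)]
  simp_rw [hφψ h (le_add_self.trans hsh) v hv, Real.exp_add (φ h v)]
  rw [integral_const_mul, hφψ s (le_self_add.trans hsh) _ hψv, ← Real.exp_add]
  congr 1
  ring

/-- If `ψ_t` is constant on a nontrivial interval, then it vanishes on the interior of `𝒱 ∩ ℝ`. -/
lemma IsExponentPair.eqOn_zero_of_const (hφψ : IsExponentPair X P T φ ψ)
    (hX : IsAnalyticAffine 𝓕 X P T) {t : ℝ≥0} (ht : t ≤ T) {v w : ℝ} (hvw : v < w)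
    (hv : v ∈ realMomentSet X P T) (hw : w ∈ realMomentSet X P T)
    (hc : ∀ z ∈ Icc v w, ψ t z = ψ t v) :
    ∀ z ∈ interior (realMomentSet X P T), ψ t z = 0 := by
  set I := realMomentSet X P T
  set x₀ : D := ⟨0, hX.nonneg_mem le_rfl⟩
  set x₁ : D := ⟨1, hX.nonneg_mem zero_le_one⟩
  set F : D → ℝ → ℝ := fun x => mgf (fun ω => (X t ω : ℝ)) (P x)
  have hsub : ∀ x : D, interior I ⊆ interior (integrableExpSet (fun ω => (X t ω : ℝ)) (P x)) :=
    fun x => interior_mono (realMomentSet_subset hX.isMarkov ht x)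
  have hI : Icc v w ⊆ I := (ordConnected_realMomentSet hX.isMarkov).out hv hw
  -- Constancy of `ψ_t` on `[v, w]` says that the moment generating function from `1` is a fixed
  -- multiple of the one from `0`. By analyticity this persists on the whole interior, and the
  -- constant is found at the argument `0`.
  have h0 : AnalyticOnNhd ℝ (fun z => Real.exp (ψ t v) * F x₀ z) (interior I) :=
    analyticOnNhd_const.mul (analyticOnNhd_mgf.mono (hsub x₀))
  have h1 : AnalyticOnNhd ℝ (F x₁) (interior I) := analyticOnNhd_mgf.mono (hsub x₁)
  have hmid : (v + w) / 2 ∈ Ioo v w := ⟨by linarith, by linarith⟩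
  have hIoo : Ioo v w ⊆ interior I :=
    interior_maximal (Ioo_subset_Icc_self.trans hI) isOpen_Ioo
  have heq := h1.eqOn_of_preconnected_of_eventuallyEq h0
    (convex_interior_realMomentSet hX.isMarkov).isPreconnected (hIoo hmid) (by
      filter_upwards [isOpen_Ioo.mem_nhds hmid] with z hz
      have hzI := hI (Ioo_subset_Icc_self hz)
      simp only [F]
      rw [hφψ.mgf_eq ht hzI, hφψ.mgf_eq ht hzI, hc z (Ioo_subset_Icc_self hz), ← Real.exp_add]
      simp only [x₀, x₁]
      congr 1
      ring)
  have hval : ∀ z ∈ interior I, ψ t z = ψ t v := by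
    intro z hz
    have := heq hz
    simp only [F] at this
    rw [hφψ.mgf_eq ht (interior_subset hz), hφψ.mgf_eq ht (interior_subset hz),
      ← Real.exp_add] at this
    have := Real.exp_injective this
    simp only [x₀, x₁] at this
    linarith
  intro z hz
  rw [hval z hz, ← hval 0 hX.zero_mem_interior, (hφψ.apply_zero hX ht).2]

lemma IsExponentPair.linear_of_univ (hφψ : IsExponentPair X P T φ ψ)
    (hX : IsAnalyticAffine 𝓕 X P T) (hD : D = univ) {t : ℝ≥0} (ht : t ≤ T) :
    ∃ m : ℝ, ∀ v ∈ realMomentSet X P T, ψ t v = m * v := by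
  obtain ⟨ε, hε, hball⟩ := Metric.mem_nhds_iff.1 (mem_interior_iff_mem_nhds.1 hX.zero_mem_interior)
  have he : ε / 2 ∈ realMomentSet X P T := hball (by
    rw [Metric.mem_ball, dist_zero_right, Real.norm_of_nonneg (by positivity)]; linarith)
  have h0 : (0 : ℝ) ∈ realMomentSet X P T := interior_subset hX.zero_mem_interior
  have hz := (hφψ.apply_zero hX ht).2
  set e := ε / 2
  have hepos : 0 < e := by positivity
  refine ⟨ψ t e / e, fun v hv => ?_⟩
  rcases lt_or_ge v 0 with hneg | hpos
  · have hden : 0 < e - v := by linarith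
    -- For `v < 0 < e` these weights exhibit `0` as a convex combination of `e` and `v`.
    have := hφψ.affine_of_univ hX hD ht he hv (a := -v / (e - v)) (b := e / (e - v))
      (div_nonneg (by linarith) hden.le) (by positivity) (by field_simp; ring)
    rw [show -v / (e - v) * e + e / (e - v) * v = 0 by field_simp; ring, hz] at this
    field_simp at this ⊢
    linarith
  · rcases le_total v e with hve | hve
    · have := hφψ.affine_of_univ hX hD ht he h0 (a := v / e) (b := 1 - v / e)
        (by positivity) (sub_nonneg.2 ((div_le_one hepos).2 hve)) (by ring)
      rw [hz, mul_zero, add_zero, add_zero, div_mul_cancel₀ _ hepos.ne'] at this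
      rw [this]
      ring
    · have hvpos : 0 < v := hepos.trans_le hve
      have := hφψ.affine_of_univ hX hD ht hv h0 (a := e / v) (b := 1 - e / v)
        (by positivity) (sub_nonneg.2 ((div_le_one hvpos).2 hve)) (by ring)
      rw [hz, mul_zero, add_zero, add_zero, div_mul_cancel₀ _ hvpos.ne'] at this
      rw [this]
      field_simp

/-- If `ψ_t` is not injective on `𝒱 ∩ ℝ`, then it vanishes on the interior of `𝒱 ∩ ℝ`. -/
lemma IsExponentPair.eqOn_zero_of_not_injOn (hφψ : IsExponentPair X P T φ ψ)
    (hX : IsAnalyticAffine 𝓕 X P T) {t : ℝ≥0} (ht : t ≤ T)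
    (hinj : ¬ InjOn (ψ t) (realMomentSet X P T)) :
    ∀ z ∈ interior (realMomentSet X P T), ψ t z = 0 := by
  have : ∃ v ∈ realMomentSet X P T, ∃ w ∈ realMomentSet X P T, v < w ∧ ψ t v = ψ t w := by
    simp only [InjOn, not_forall] at hinj
    obtain ⟨v, hv, w, hw, h, hne⟩ := hinj
    rcases lt_or_gt_of_ne hne with hlt | hlt
    exacts [⟨v, hv, w, hw, hlt, h⟩, ⟨w, hw, v, hv, hlt, h.symm⟩]
  obtain ⟨v, hv, w, hw, hvw, h⟩ := this
  have hI : Icc v w ⊆ realMomentSet X P T := (ordConnected_realMomentSet hX.isMarkov).out hv hw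
  refine hφψ.eqOn_zero_of_const hX ht hvw hv hw fun z hz => ?_
  rcases hX.stateSpace with hD | hD
  · have hmono := hφψ.monotoneOn_of_Ici hX hD ht
    exact le_antisymm ((hmono (hI hz) hw hz.2).trans_eq h.symm) (hmono hv (hI hz) hz.1)
  · obtain ⟨m, hm⟩ := hφψ.linear_of_univ hX hD ht
    have hm0 : m = 0 := by
      rw [hm v hv, hm w hw] at h
      have : m * (w - v) = 0 := by linarith
      rcases mul_eq_zero.1 this with h | h
      · exact h
      · linarith
    rw [hm z (hI hz), hm v hv, hm0, zero_mul, zero_mul]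

/-- Near `0`, `ψ_t` takes values near `0`. -/
lemma IsExponentPair.exists_pos_mem (hφψ : IsExponentPair X P T φ ψ)
    (hX : IsAnalyticAffine 𝓕 X P T) {t : ℝ≥0} (ht : t ≤ T) :
    ∃ v, 0 < v ∧ v ∈ interior (realMomentSet X P T) ∧
      ψ t v ∈ interior (realMomentSet X P T) := by
  set I := realMomentSet X P T
  set x₀ : D := ⟨0, hX.nonneg_mem le_rfl⟩ with hx₀
  set x₁ : D := ⟨1, hX.nonneg_mem zero_le_one⟩ with hx₁
  have hcont : ∀ x : D, ContinuousAt (mgf (fun ω => (X t ω : ℝ)) (P x)) 0 := fun x =>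
    continuousOn_mgf.continuousAt (isOpen_interior.mem_nhds
      (interior_mono (realMomentSet_subset hX.isMarkov ht x) hX.zero_mem_interior))
  -- The difference of the cumulant generating functions from `1` and from `0` is `ψ_t`, which gives
  -- its continuity at `0`.
  have hlog : ContinuousAt (fun v => Real.log (mgf (fun ω => (X t ω : ℝ)) (P x₁) v)
      - Real.log (mgf (fun ω => (X t ω : ℝ)) (P x₀) v)) 0 :=
    ((hcont x₁).log (by simp)).sub ((hcont x₀).log (by simp))
  have heq : ∀ v ∈ I, Real.log (mgf (fun ω => (X t ω : ℝ)) (P x₁) v)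
      - Real.log (mgf (fun ω => (X t ω : ℝ)) (P x₀) v) = ψ t v := by
    intro v hv
    rw [hφψ.mgf_eq ht hv, hφψ.mgf_eq ht hv, Real.log_exp, Real.log_exp]
    simp [hx₀, hx₁]
  have hnhds : ∀ᶠ v in 𝓝 (0 : ℝ), v ∈ interior I :=
    isOpen_interior.mem_nhds hX.zero_mem_interior
  have h2 : ∀ᶠ v in 𝓝 (0 : ℝ), v ∈ interior I ∧ ψ t v ∈ interior I := by
    have := hlog.eventually_mem (s := interior I)
      (isOpen_interior.mem_nhds (by simpa using hX.zero_mem_interior))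
    filter_upwards [hnhds, this] with v hv hv'
    exact ⟨hv, heq v (interior_subset hv) ▸ hv'⟩
  obtain ⟨v, ⟨h, h'⟩, hv⟩ :=
    ((h2.filter_mono nhdsWithin_le_nhds).and (self_mem_nhdsWithin (s := Ioi (0 : ℝ)))).exists
  exact ⟨v, hv, h, h'⟩

/-- Otherwise `ψ_h` is injective. For a small `v > 0` the flow property gives `ψ_h(ψ_h(v)) = 0 =
ψ_h(0)`, so injectivity applied twice yields `v = 0`. -/
lemma IsExponentPair.eqOn_zero_half (hφψ : IsExponentPair X P T φ ψ)
    (hX : IsAnalyticAffine 𝓕 X P T) {h : ℝ≥0} (hT : h + h ≤ T)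
    (hz : ∀ z ∈ interior (realMomentSet X P T), ψ (h + h) z = 0) :
    ∀ z ∈ interior (realMomentSet X P T), ψ h z = 0 := by
  have hhT : h ≤ T := le_self_add.trans hT
  by_contra hne
  have hinj : InjOn (ψ h) (realMomentSet X P T) := by
    by_contra hinj
    exact hne (hφψ.eqOn_zero_of_not_injOn hX hhT hinj)
  have h0 := interior_subset hX.zero_mem_interior
  obtain ⟨v, hv0, hv, hψv⟩ := hφψ.exists_pos_mem hX hhT
  have h1 := hφψ.flow hX hT (interior_subset hv) (interior_subset hψv)
  rw [hz v hv, ← (hφψ.apply_zero hX hhT).2] at h1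
  have h2 := hinj h0 (interior_subset hψv) h1
  have h3 := hinj h0 (interior_subset hv) ((hφψ.apply_zero hX hhT).2.trans h2)
  exact hv0.ne h3

/-- Repeated halving would make `ψ` vanish at the times `t / 2^n`, so the laws there would not
distinguish the starting points `0` and `1`. Stochastic continuity at time `0` concentrates them
near `0` and near `1` respectively. -/
lemma IsExponentPair.not_eqOn_zero (hφψ : IsExponentPair X P T φ ψ)
    (hX : IsAnalyticAffine 𝓕 X P T) {t : ℝ≥0} (ht : t ≤ T) :
    ¬ ∀ z ∈ interior (realMomentSet X P T), ψ t z = 0 := by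
  intro hz
  set x₀ : D := ⟨0, hX.nonneg_mem le_rfl⟩ with hx₀
  set x₁ : D := ⟨1, hX.nonneg_mem zero_le_one⟩ with hx₁
  have htn : ∀ n : ℕ, t / 2 ^ n ≤ T := fun n =>
    (div_le_self zero_le (one_le_pow₀ one_le_two)).trans ht
  have hall : ∀ n : ℕ, ∀ z ∈ interior (realMomentSet X P T), ψ (t / 2 ^ n) z = 0 := by
    intro n
    induction n with
    | zero => simpa using hz
    | succ n ih =>
      have hd : t / 2 ^ (n + 1) + t / 2 ^ (n + 1) = t / 2 ^ n := by
        rw [pow_succ, ← div_div, add_halves]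
      exact hφψ.eqOn_zero_half hX (hd ▸ htn n) (hd ▸ ih)
  have hlaw : ∀ n : ℕ, (P x₀).map (fun ω => (X (t / 2 ^ n) ω : ℝ))
      = (P x₁).map (fun ω => (X (t / 2 ^ n) ω : ℝ)) := by
    intro n
    refine map_eq_map_of_mgf_eqOn (hX.isMarkov.measurable_coe (htn n)) isOpen_interior
      (convex_interior_realMomentSet hX.isMarkov) hX.zero_mem_interior
      (interior_subset.trans (realMomentSet_subset hX.isMarkov (htn n) _))
      (interior_subset.trans (realMomentSet_subset hX.isMarkov (htn n) _)) fun z hz' => ?_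
    rw [hφψ.mgf_eq (htn n) (interior_subset hz'), hφψ.mgf_eq (htn n) (interior_subset hz'),
      hall n z hz', zero_mul, zero_mul]
  have hlim : Tendsto (fun n : ℕ => t / 2 ^ n) atTop (𝓝[Iic T] 0) := by
    refine tendsto_nhdsWithin_iff.2 ⟨?_, Eventually.of_forall htn⟩
    have h2 : Tendsto (fun n : ℕ => ((2 : ℝ≥0)⁻¹) ^ n) atTop (𝓝 0) :=
      NNReal.tendsto_pow_atTop_nhds_zero_of_lt_one (by
        rw [← NNReal.coe_lt_coe]; push_cast; norm_num)
    have := h2.const_mul t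
    simpa [div_eq_mul_inv] using this
  have hconv : ∀ x : D, Tendsto (fun n : ℕ =>
      ((P x).map (fun ω => (X (t / 2 ^ n) ω : ℝ))) {r | 1 / 2 ≤ |r - x|}) atTop (𝓝 0) := by
    intro x
    have h1 := (tendstoInMeasure_iff_dist.1 (hX.stochCont x 0 zero_le) (1 / 2)
      (by norm_num)).comp hlim
    refine h1.congr fun n => ?_
    rw [Measure.map_apply (hX.isMarkov.measurable_coe (htn n))
      (measurableSet_le measurable_const (by fun_prop))]
    refine measure_congr ?_
    refine eventuallyEq_set.2 ?_
    filter_upwards [hX.isMarkov.initial x] with ω hω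
    simp [Real.dist_eq, hω]
  have hsum := (hconv x₀).add (hconv x₁)
  -- No real number is within less than `1/2` of both `0` and `1`, so under a common law the two
  -- sets have total mass at least `1`, while both masses tend to `0`.
  have hge : ∀ n : ℕ, 1 ≤ ((P x₀).map (fun ω => (X (t / 2 ^ n) ω : ℝ))) {r | 1 / 2 ≤ |r - x₀|}
      + ((P x₁).map (fun ω => (X (t / 2 ^ n) ω : ℝ))) {r | 1 / 2 ≤ |r - x₁|} := by
    intro n
    rw [hlaw n]
    have := Measure.isProbabilityMeasure_map (μ := P x₁)
      (hX.isMarkov.measurable_coe (htn n)).aemeasurable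
    refine le_trans ?_ (measure_union_le _ _)
    rw [← measure_univ (μ := (P x₁).map (fun ω => (X (t / 2 ^ n) ω : ℝ)))]
    refine measure_mono fun r _ => ?_
    by_contra hr
    simp only [mem_union, mem_ofPred_eq, not_or, not_le, hx₀, hx₁, abs_lt] at hr
    linarith [hr.1.2, hr.2.1]
  have := ge_of_tendsto' hsum hge
  simp at this

/-- `ψ_t` is strictly increasing on `𝒱 ∩ ℝ`. -/
lemma IsExponentPair.strictMonoOn (hφψ : IsExponentPair X P T φ ψ)
    (hX : IsAnalyticAffine 𝓕 X P T) {t : ℝ≥0} (ht : t ≤ T) :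
    StrictMonoOn (ψ t) (realMomentSet X P T) := by
  have hinj : ∀ {s : ℝ≥0}, s ≤ T → InjOn (ψ s) (realMomentSet X P T) := by
    intro s hs
    by_contra h
    exact hφψ.not_eqOn_zero hX hs (hφψ.eqOn_zero_of_not_injOn hX hs h)
  rcases hX.stateSpace with hD | hD
  · intro v hv w hw hvw
    exact lt_of_le_of_ne (hφψ.monotoneOn_of_Ici hX hD ht hv hw hvw.le)
      fun h => hvw.ne (hinj ht hv hw h)
  -- On the line, injectivity alone would allow a decreasing `ψ_t`. By the flow property its slope
  -- is the square of the slope of `ψ_{t/2}`, hence positive.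
  · have hh : t / 2 ≤ T := (div_le_self zero_le one_le_two).trans ht
    obtain ⟨m, hm⟩ := hφψ.linear_of_univ hX hD ht
    obtain ⟨m', hm'⟩ := hφψ.linear_of_univ hX hD hh
    obtain ⟨v, hv0, hv, hψv⟩ := hφψ.exists_pos_mem hX hh
    have hv := interior_subset hv
    have hψv := interior_subset hψv
    have hfl := hφψ.flow hX (s := t / 2) (h := t / 2) (by rwa [add_halves]) hv hψv
    rw [add_halves, hm v hv, hm' _ hψv, hm' v hv] at hfl
    have hm2 : m = m' ^ 2 := by
      have : (m - m' ^ 2) * v = 0 := by linarith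
      rcases mul_eq_zero.1 this with h | h <;> linarith
    have hm0 : m ≠ 0 := by
      rintro rfl
      exact hφψ.not_eqOn_zero hX ht fun z hz => by rw [hm z (interior_subset hz), zero_mul]
    have hmpos : 0 < m := lt_of_le_of_ne (hm2 ▸ sq_nonneg m') hm0.symm
    intro a ha b hb hab
    rw [hm a ha, hm b hb]
    exact mul_lt_mul_of_pos_left hab hmpos

end Affine

/-! ### The exercise interval -/

section PayoffInterval

variable {g : ℝ → ℝ} {κ₁ κ₂ : ℝ}

lemma IsPayoffInterval.le (h : IsPayoffInterval g κ₁ κ₂) : κ₁ ≤ κ₂ := by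
  obtain ⟨-, ξ, h1, h2, -⟩ := h
  exact h1.trans h2

/-- A nonempty open interval contains a point where `g` is positive, so the maximum is nonnegative
and the endpoints are roots. Either alternative makes the boundary terms of the Fourier transform
cancel. -/
lemma IsPayoffInterval.eq_or_roots (h : IsPayoffInterval g κ₁ κ₂) :
    κ₁ = κ₂ ∨ g κ₁ = 0 ∧ g κ₂ = 0 := by
  obtain ⟨hpos, ξ, h1, h2, hmax, hroot⟩ := h
  rcases (h1.trans h2).eq_or_lt with heq | hlt
  · exact Or.inl heq
  · have hm : 0 < g ((κ₁ + κ₂) / 2) := (hpos _).2 ⟨by linarith, by linarith⟩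
    refine Or.inr (hroot ?_)
    by_cases hξ : (κ₁ + κ₂) / 2 = ξ
    · exact hξ ▸ hm.le
    · exact (hm.trans (hmax _ hξ)).le

lemma IsPayoffInterval.max_eq_indicator (h : IsPayoffInterval g κ₁ κ₂) (x : ℝ) :
    max (g x) 0 = (Ioo κ₁ κ₂).indicator g x := by
  by_cases hx : x ∈ Ioo κ₁ κ₂
  · rw [indicator_of_mem hx, max_eq_left ((h.1 x).2 hx).le]
  · rw [indicator_of_notMem hx, max_eq_right (not_lt.1 fun h' => hx ((h.1 x).1 h'))]

/-- The maximum point is unique, so `ξ` in `IsPayoffInterval` is forced. If `g ξ < 0` the interval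
collapses to `ξ`; otherwise the intermediate value theorem gives a root on each side, unique by
strict monotonicity. -/
lemma existsUnique_isPayoffInterval (hg : Continuous g) {ξ : ℝ} (hmono : StrictMonoOn g (Iic ξ))
    (hanti : StrictAntiOn g (Ici ξ)) (hl : ∃ x ≤ ξ, g x < 0) (hr : ∃ x, ξ ≤ x ∧ g x < 0) :
    ∃! κ : ℝ × ℝ, IsPayoffInterval g κ.1 κ.2 := by
  have hmax : ∀ x, x ≠ ξ → g x < g ξ := by
    intro x hx
    rcases lt_or_gt_of_ne hx with h | h
    · exact hmono h.le self_mem_Iic h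
    · exact hanti self_mem_Ici h.le h
  have hξ : ∀ {η}, (∀ x, x ≠ η → g x < g η) → η = ξ := by
    intro η hη
    by_contra hne
    exact lt_asymm (hmax η hne) (hη ξ (Ne.symm hne))
  rcases lt_or_ge (g ξ) 0 with hneg | hpos
  · have hall : ∀ x, g x < 0 := by
      intro x
      by_cases hx : x = ξ
      · exact hx ▸ hneg
      · exact (hmax x hx).trans hneg
    refine ⟨(ξ, ξ), ⟨fun x => ⟨fun h => absurd h (hall x).not_gt,
      fun h => absurd (h.1.trans h.2) (lt_irrefl _)⟩,
      ξ, le_rfl, le_rfl, hmax, fun h => absurd h hneg.not_ge⟩, ?_⟩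
    rintro ⟨κ₁, κ₂⟩ h
    have heq : κ₁ = κ₂ := by
      rcases h.eq_or_roots with h' | h'
      · exact h'
      · exact absurd h'.1 (hall _).ne
    obtain ⟨-, η, h1, h2, hη, -⟩ := h
    have := hξ hη
    simp only at h1 h2 heq
    ext <;> simp only <;> linarith
  · obtain ⟨x₁, hx₁, hgx₁⟩ := hl
    obtain ⟨x₂, hx₂, hgx₂⟩ := hr
    obtain ⟨κ₁, hκ₁, hgκ₁⟩ := intermediate_value_Icc hx₁ hg.continuousOn ⟨hgx₁.le, hpos⟩
    obtain ⟨κ₂, hκ₂, hgκ₂⟩ := intermediate_value_Icc' hx₂ hg.continuousOn ⟨hgx₂.le, hpos⟩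
    refine ⟨(κ₁, κ₂), ⟨fun x => ?_, ξ, hκ₁.2, hκ₂.1, hmax, fun _ => ⟨hgκ₁, hgκ₂⟩⟩, ?_⟩
    · simp only
      rcases le_total x ξ with hx | hx
      · rw [← hgκ₁, hmono.lt_iff_lt hκ₁.2 hx]
        refine ⟨fun h => ⟨h, ?_⟩, fun h => h.1⟩
        refine lt_of_le_of_ne (hx.trans hκ₂.1) fun h' => ?_
        have : x = ξ := le_antisymm hx (h' ▸ hκ₂.1)
        have h2 := hmono hκ₁.2 hx h
        rw [h', hgκ₁, hgκ₂] at h2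
        exact lt_irrefl _ h2
      · rw [← hgκ₂, hanti.lt_iff_gt hκ₂.1 hx]
        refine ⟨fun h => ⟨?_, h⟩, fun h => h.2⟩
        refine lt_of_le_of_ne (hκ₁.2.trans hx) fun h' => ?_
        have h2 := hanti hx hκ₂.1 h
        rw [← h', hgκ₁, hgκ₂] at h2
        exact lt_irrefl _ h2
    · rintro ⟨κ₁', κ₂'⟩ ⟨-, η, h1, h2, hη, hroot⟩
      obtain rfl := hξ hη
      obtain ⟨hr1, hr2⟩ := hroot hpos
      exact Prod.ext (hmono.injOn h1 hκ₁.2 (hr1.trans hgκ₁.symm))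
        (hanti.injOn h2 hκ₂.1 (hr2.trans hgκ₂.symm))

end PayoffInterval

/-! ### Quotients of exponential sums -/

section ExpSum

variable {ι : Type*} {J : Finset ι} {c a : ι → ℝ} {α β p q r s : ℝ}

lemma expSum_pos (hc : ∀ i ∈ J, 0 ≤ c i) (hc' : ∃ i ∈ J, 0 < c i) (x : ℝ) :
    0 < ∑ i ∈ J, c i * Real.exp (a i * x) := by
  obtain ⟨i, hi, hci⟩ := hc'
  exact Finset.sum_pos' (fun i hi => mul_nonneg (hc i hi) (Real.exp_pos _).le)
    ⟨i, hi, mul_pos hci (Real.exp_pos _)⟩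

lemma hasDerivAt_expSum (x : ℝ) :
    HasDerivAt (fun x => ∑ i ∈ J, c i * Real.exp (a i * x))
      (∑ i ∈ J, c i * (a i * Real.exp (a i * x))) x := by
  refine HasDerivAt.fun_sum fun i _ => HasDerivAt.const_mul _ ?_
  have := ((hasDerivAt_id x).const_mul (a i)).exp
  simpa [mul_comm] using this

/-- The numerator of the derivative of the quotient, up to a positive factor, is strictly
increasing. -/
lemma strictMono_wronskian (hα : 0 < α) (hβ : 0 < β) (hqs : q < s) (hrp : r < p)
    (hc : ∀ i ∈ J, 0 ≤ c i) (hc' : ∃ i ∈ J, 0 < c i) (ha : ∀ i ∈ J, s ≤ a i ∧ a i ≤ r) :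
    StrictMono fun x => ∑ i ∈ J, c i * (α * (p - a i) * Real.exp ((a i - s) * x)
      - β * (a i - q) * Real.exp ((q + a i - p - s) * x)) := by
  intro x y hxy
  have hlt : ∀ i ∈ J, α * (p - a i) * Real.exp ((a i - s) * x)
      - β * (a i - q) * Real.exp ((q + a i - p - s) * x)
      < α * (p - a i) * Real.exp ((a i - s) * y)
      - β * (a i - q) * Real.exp ((q + a i - p - s) * y) := by
    intro i hi
    obtain ⟨h1, h2⟩ := ha i hi
    -- Dividing the numerator of the derivative by `e^{(p+s)x}` makes the exponents with positive
    -- coefficients nonnegative and, because `(a i - p) + (q - s) < 0`, those with negative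
    -- coefficients strictly negative.
    have e1 : Real.exp ((a i - s) * x) ≤ Real.exp ((a i - s) * y) :=
      Real.exp_le_exp.2 (mul_le_mul_of_nonneg_left hxy.le (by linarith))
    have e2 : Real.exp ((q + a i - p - s) * y) < Real.exp ((q + a i - p - s) * x) :=
      Real.exp_lt_exp.2 (mul_lt_mul_of_neg_left hxy (by linarith))
    have f1 := mul_le_mul_of_nonneg_left e1 (mul_nonneg hα.le (by linarith : 0 ≤ p - a i))
    have f2 := mul_lt_mul_of_pos_left e2 (mul_pos hβ (by linarith : 0 < a i - q))
    linarith
  obtain ⟨i, hi, hci⟩ := hc'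
  exact Finset.sum_lt_sum (fun i hi => mul_le_mul_of_nonneg_left (hlt i hi).le (hc i hi))
    ⟨i, hi, mul_lt_mul_of_pos_left (hlt i hi) hci⟩

lemma hasDerivAt_expSum_quotient (hc : ∀ i ∈ J, 0 ≤ c i) (hc' : ∃ i ∈ J, 0 < c i) (s x : ℝ) :
    HasDerivAt (fun x => (α * Real.exp (p * x) + β * Real.exp (q * x))
        / ∑ i ∈ J, c i * Real.exp (a i * x))
      (Real.exp ((p + s) * x) / (∑ i ∈ J, c i * Real.exp (a i * x)) ^ 2 *
        ∑ i ∈ J, c i * (α * (p - a i) * Real.exp ((a i - s) * x)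
          - β * (a i - q) * Real.exp ((q + a i - p - s) * x))) x := by
  have hexp : ∀ d : ℝ, HasDerivAt (fun x => Real.exp (d * x)) (d * Real.exp (d * x)) x := by
    intro d
    have := ((hasDerivAt_id x).const_mul d).exp
    simpa [mul_comm] using this
  have hG := hasDerivAt_expSum (J := J) (c := c) (a := a) x
  have h := (((hexp p).const_mul α).add ((hexp q).const_mul β)).div hG
    (expSum_pos hc hc' x).ne'
  convert! h using 1
  rw [div_mul_eq_mul_div, Finset.mul_sum, Pi.add_apply]
  congr 1
  rw [Finset.mul_sum, Finset.mul_sum, ← Finset.sum_sub_distrib]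
  refine Finset.sum_congr rfl fun i _ => ?_
  have e1 : Real.exp ((p + s) * x) * Real.exp ((a i - s) * x)
      = Real.exp (p * x) * Real.exp (a i * x) := by
    rw [← Real.exp_add, ← Real.exp_add]; ring_nf
  have e2 : Real.exp ((p + s) * x) * Real.exp ((q + a i - p - s) * x)
      = Real.exp (q * x) * Real.exp (a i * x) := by
    rw [← Real.exp_add, ← Real.exp_add]; ring_nf
  linear_combination c i * α * (p - a i) * e1 - c i * β * (a i - q) * e2

/-- For `x ≥ 0` the denominator is at most `(∑ c i) e^{rx}`, so the quotient dominates a positive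
multiple of `e^{(p-r)x}`. -/
lemma tendsto_expSum_quotient_atTop (hα : 0 < α) (hβ : 0 < β) (hrp : r < p)
    (hc : ∀ i ∈ J, 0 ≤ c i) (hc' : ∃ i ∈ J, 0 < c i) (ha : ∀ i ∈ J, a i ≤ r) :
    Tendsto (fun x => (α * Real.exp (p * x) + β * Real.exp (q * x))
      / ∑ i ∈ J, c i * Real.exp (a i * x)) atTop atTop := by
  have hC : 0 < ∑ i ∈ J, c i := by
    obtain ⟨i, hi, hci⟩ := hc'
    exact Finset.sum_pos' hc ⟨i, hi, hci⟩
  have hlim : Tendsto (fun x => α / (∑ i ∈ J, c i) * Real.exp ((p - r) * x)) atTop atTop :=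
    (Real.tendsto_exp_atTop.comp (tendsto_id.const_mul_atTop (sub_pos.2 hrp))).const_mul_atTop
      (by positivity)
  refine tendsto_atTop_mono' _ ?_ hlim
  filter_upwards [eventually_ge_atTop 0] with x hx
  rw [le_div_iff₀ (expSum_pos hc hc' x)]
  have h1 : ∑ i ∈ J, c i * Real.exp (a i * x) ≤ (∑ i ∈ J, c i) * Real.exp (r * x) := by
    rw [Finset.sum_mul]
    exact Finset.sum_le_sum fun i hi => mul_le_mul_of_nonneg_left
      (Real.exp_le_exp.2 (mul_le_mul_of_nonneg_right (ha i hi) hx)) (hc i hi)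
  calc α / (∑ i ∈ J, c i) * Real.exp ((p - r) * x) * ∑ i ∈ J, c i * Real.exp (a i * x)
      ≤ α / (∑ i ∈ J, c i) * Real.exp ((p - r) * x) * ((∑ i ∈ J, c i) * Real.exp (r * x)) :=
        mul_le_mul_of_nonneg_left h1 (by positivity)
    _ = α * (Real.exp ((p - r) * x) * Real.exp (r * x)) := by field_simp
    _ = α * Real.exp (p * x) := by rw [← Real.exp_add]; ring_nf
    _ ≤ _ := le_add_of_nonneg_right (by positivity)

lemma tendsto_expSum_quotient_atBot (hα : 0 < α) (hβ : 0 < β) (hqs : q < s)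
    (hc : ∀ i ∈ J, 0 ≤ c i) (hc' : ∃ i ∈ J, 0 < c i) (ha : ∀ i ∈ J, s ≤ a i) :
    Tendsto (fun x => (α * Real.exp (p * x) + β * Real.exp (q * x))
      / ∑ i ∈ J, c i * Real.exp (a i * x)) atBot atTop := by
  have := (tendsto_expSum_quotient_atTop (J := J) (c := c) (a := fun i => -a i) (p := -q)
    (q := -p) (r := -s) hβ hα (neg_lt_neg hqs) hc hc'
    (fun i hi => neg_le_neg (ha i hi))).comp tendsto_neg_atBot_atTop
  refine this.congr fun x => ?_
  simp only [Function.comp, neg_mul_neg]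
  rw [add_comm]

/-- The quotient `(α e^{px} + β e^{qx}) / ∑ c_i e^{a_i x}`, where all `a_i` lie strictly between
`q` and `p`, is strictly decreasing up to some point and strictly increasing from there on. -/
lemma exists_strictAntiOn_strictMonoOn (hα : 0 < α) (hβ : 0 < β) (hqs : q < s) (hrp : r < p)
    (hc : ∀ i ∈ J, 0 ≤ c i) (hc' : ∃ i ∈ J, 0 < c i) (ha : ∀ i ∈ J, s ≤ a i ∧ a i ≤ r) :
    ∃ ξ, StrictAntiOn (fun x => (α * Real.exp (p * x) + β * Real.exp (q * x))
        / ∑ i ∈ J, c i * Real.exp (a i * x)) (Iic ξ) ∧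
      StrictMonoOn (fun x => (α * Real.exp (p * x) + β * Real.exp (q * x))
        / ∑ i ∈ J, c i * Real.exp (a i * x)) (Ici ξ) := by
  set Q := fun x => (α * Real.exp (p * x) + β * Real.exp (q * x))
        / ∑ i ∈ J, c i * Real.exp (a i * x)
  set W := fun x => ∑ i ∈ J, c i * (α * (p - a i) * Real.exp ((a i - s) * x)
      - β * (a i - q) * Real.exp ((q + a i - p - s) * x))
  have hW : StrictMono W := strictMono_wronskian hα hβ hqs hrp hc hc' ha
  have hderiv : ∀ x, HasDerivAt Q (Real.exp ((p + s) * x)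
      / (∑ i ∈ J, c i * Real.exp (a i * x)) ^ 2 * W x) x :=
    hasDerivAt_expSum_quotient hc hc' s
  have hpos : ∀ x, 0 < Real.exp ((p + s) * x) / (∑ i ∈ J, c i * Real.exp (a i * x)) ^ 2 :=
    fun x => div_pos (Real.exp_pos _) (pow_pos (expSum_pos hc hc' x) 2)
  have hcont : Continuous Q :=
    continuous_iff_continuousAt.2 fun x => (hderiv x).continuousAt
  have hlim : Tendsto Q (cocompact ℝ) atTop := by
    rw [cocompact_eq_atBot_atTop]
    exact (tendsto_expSum_quotient_atBot hα hβ hqs hc hc' fun i hi => (ha i hi).1).sup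
      (tendsto_expSum_quotient_atTop hα hβ hrp hc hc' fun i hi => (ha i hi).2)
  -- Growth at both ends provides a global minimum. The strictly increasing factor `W` vanishes
  -- there, so it fixes the sign of the derivative on each side.
  obtain ⟨ξ, hξ⟩ := hcont.exists_forall_le hlim
  have hWξ : W ξ = 0 := by
    have hmin : IsLocalMin Q ξ := Eventually.of_forall hξ
    have := hmin.hasDerivAt_eq_zero (hderiv ξ)
    exact (mul_eq_zero.1 this).resolve_left (hpos ξ).ne'
  refine ⟨ξ, strictAntiOn_of_deriv_neg (convex_Iic ξ) hcont.continuousOn fun x hx => ?_,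
    strictMonoOn_of_deriv_pos (convex_Ici ξ) hcont.continuousOn fun x hx => ?_⟩
  · rw [interior_Iic] at hx
    rw [(hderiv x).deriv]
    exact mul_neg_of_pos_of_neg (hpos x) (hWξ ▸ hW hx)
  · rw [interior_Ici] at hx
    rw [(hderiv x).deriv]
    exact mul_pos (hpos x) (hWξ ▸ hW hx)

end ExpSum

/-! ### Fourier inversion -/

section Inversion

variable {f : ℝ → ℝ} {R C : ℝ}

/-- On the line `Im z = -R` the extended transform is the ordinary Fourier transform of the damped
function `e^{-Rx} f(x)`. -/
lemma fourierExt_eq (f : ℝ → ℝ) (R y : ℝ) :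
    fourierExt f (y - Complex.I * R)
      = ∫ x : ℝ, Complex.exp (((-(y * x) : ℝ) : ℂ) * Complex.I) *
          ((Real.exp (-(R * x)) * f x : ℝ) : ℂ) := by
  refine integral_congr_ae (ae_of_all _ fun x => ?_)
  simp only [Complex.ofReal_mul, Complex.ofReal_exp, ← mul_assoc, ← Complex.exp_add]
  congr 2
  push_cast
  linear_combination (R * x : ℂ) * Complex.I_mul_I

lemma integrable_exp_mul (hf : Continuous f) (hfc : HasCompactSupport f) (R : ℝ) :
    Integrable fun x => Real.exp (-(R * x)) * f x :=
  Continuous.integrable_of_hasCompactSupport (by fun_prop) hfc.mul_left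

lemma norm_fourierExt_le (f : ℝ → ℝ) (R y : ℝ) :
    ‖fourierExt f (y - Complex.I * R)‖ ≤ ∫ x : ℝ, ‖Real.exp (-(R * x)) * f x‖ := by
  rw [fourierExt_eq]
  refine (norm_integral_le_integral_norm _).trans_eq (integral_congr_ae (ae_of_all _ fun x => ?_))
  simp only [norm_mul, Complex.norm_exp_ofReal_mul_I, one_mul, Complex.norm_real]

lemma continuous_fourierExt (hf : Continuous f) (hfc : HasCompactSupport f) (R : ℝ) :
    Continuous fun y : ℝ => fourierExt f (y - Complex.I * R) := by
  simp_rw [fourierExt_eq]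
  refine continuous_of_dominated (bound := fun x => ‖Real.exp (-(R * x)) * f x‖)
    (fun y => Continuous.aestronglyMeasurable (by fun_prop)) (fun y => ae_of_all _ fun x => ?_)
    (integrable_exp_mul hf hfc R).norm (ae_of_all _ fun x => by fun_prop)
  simp only [norm_mul, Complex.norm_exp_ofReal_mul_I, one_mul, Complex.norm_real, le_refl]

lemma integrable_fourierExt (hf : Continuous f) (hfc : HasCompactSupport f)
    (hC : ∀ y : ℝ, ‖fourierExt f (y - Complex.I * R)‖ ≤ C * (1 + y ^ 2)⁻¹) :
    Integrable fun y : ℝ => fourierExt f (y - Complex.I * R) :=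
  (integrable_inv_one_add_sq.const_mul C).mono'
    (continuous_fourierExt hf hfc R).aestronglyMeasurable (ae_of_all _ hC)

lemma eq_integral_fourierExt (hf : Continuous f) (hfc : HasCompactSupport f)
    (hC : ∀ y : ℝ, ‖fourierExt f (y - Complex.I * R)‖ ≤ C * (1 + y ^ 2)⁻¹) (x : ℝ) :
    (f x : ℂ) = 1 / (2 * Real.pi) *
      ∫ y : ℝ, Complex.exp ((R + Complex.I * y) * x) * fourierExt f (y - Complex.I * R) := by
  set g : ℝ → ℂ := fun x => ((Real.exp (-(R * x)) * f x : ℝ) : ℂ)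
  have hpi : (2 * Real.pi : ℝ) ≠ 0 := by positivity
  have hg : Continuous g := by fun_prop
  -- The library transform carries `2π` in the exponent; the substitution `y = 2πw` accounts for the
  -- factor `1 / (2π)`.
  have hF : ∀ w : ℝ, FourierTransform.fourier g w
      = fourierExt f (((2 * Real.pi * w : ℝ) : ℂ) - Complex.I * R) := by
    intro w
    rw [fourierExt_eq, Real.fourier_real_eq_integral_exp_smul]
    refine integral_congr_ae (ae_of_all _ fun v => ?_)
    simp only [smul_eq_mul, g]
    congr 4
    ring
  have hFi : Integrable (FourierTransform.fourier g) := by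
    rw [show FourierTransform.fourier g = _ from funext hF]
    exact (integrable_fourierExt hf hfc hC).comp_mul_left' hpi
  have hinv := congrFun (hg.fourierInv_fourier_eq (integrable_exp_mul hf hfc R).ofReal hFi) x
  rw [Real.fourierInv_eq'] at hinv
  simp_rw [hF] at hinv
  have hs := Measure.integral_comp_mul_left (fun y : ℝ =>
    Complex.exp (((y * x : ℝ) : ℂ) * Complex.I) * fourierExt f ((y : ℂ) - Complex.I * R))
    (2 * Real.pi)
  have hlhs : ∫ v : ℝ, Complex.exp (((2 * Real.pi * inner ℝ v x : ℝ) : ℂ) * Complex.I) •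
        fourierExt f (((2 * Real.pi * v : ℝ) : ℂ) - Complex.I * R)
      = ∫ v : ℝ, Complex.exp (((2 * Real.pi * v * x : ℝ) : ℂ) * Complex.I) *
        fourierExt f (((2 * Real.pi * v : ℝ) : ℂ) - Complex.I * R) := by
    refine integral_congr_ae (ae_of_all _ fun v => ?_)
    simp only [smul_eq_mul, RCLike.inner_apply, conj_trivial]
    congr 4
    ring
  rw [hlhs, hs, abs_of_pos (by positivity)] at hinv
  have hfx : (f x : ℂ) = Complex.exp (R * x) * g x := by
    simp only [g, Complex.ofReal_mul, Complex.ofReal_exp, ← mul_assoc, ← Complex.exp_add]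
    simp
  rw [hfx, ← hinv, Complex.real_smul, mul_left_comm, ← integral_const_mul]
  congr 1
  · push_cast
    rw [one_div]
  · refine integral_congr_ae (ae_of_all _ fun y => ?_)
    simp only [← mul_assoc, ← Complex.exp_add]
    congr 2
    push_cast
    ring

lemma conj_fourierExt (f : ℝ → ℝ) (R y : ℝ) :
    (starRingEnd ℂ) (fourierExt f (y - Complex.I * R))
      = fourierExt f (((-y : ℝ) : ℂ) - Complex.I * R) := by
  rw [fourierExt_eq, fourierExt_eq, ← integral_conj]
  refine integral_congr_ae (ae_of_all _ fun x => ?_)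
  simp only [map_mul, ← Complex.exp_conj, Complex.conj_ofReal, Complex.conj_I]
  congr 2
  push_cast
  ring

variable {Ω : Type*} {mΩ : MeasurableSpace Ω} {μ : Measure Ω} [IsProbabilityMeasure μ] {Y : Ω → ℝ}

lemma conj_complexMGF (Y : Ω → ℝ) (μ : Measure Ω) (R y : ℝ) :
    (starRingEnd ℂ) (complexMGF Y μ (R + Complex.I * y))
      = complexMGF Y μ (R + Complex.I * ((-y : ℝ) : ℂ)) := by
  simp only [complexMGF]
  rw [← integral_conj]
  refine integral_congr_ae (ae_of_all _ fun x => ?_)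
  simp only [← Complex.exp_conj, map_mul, map_add, Complex.conj_ofReal, Complex.conj_I]
  congr 1
  push_cast
  ring

/-- The Fourier pricing formula for a payoff `f(Y)`. -/
lemma integral_eq_integral_fourierExt (hf : Continuous f) (hfc : HasCompactSupport f)
    (hC : ∀ y : ℝ, ‖fourierExt f (y - Complex.I * R)‖ ≤ C * (1 + y ^ 2)⁻¹)
    (hY : Measurable Y) (hint : Integrable (fun ω => Real.exp (R * Y ω)) μ) :
    IntegrableOn (fun y : ℝ => complexMGF Y μ (R + Complex.I * y) *
      fourierExt f (y - Complex.I * R)) (Ioi 0) ∧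
    ∫ ω, f (Y ω) ∂μ = 1 / Real.pi * ∫ y in Ioi (0 : ℝ),
      (complexMGF Y μ (R + Complex.I * y) * fourierExt f (y - Complex.I * R)).re := by
  set H : ℝ → ℂ := fun y => complexMGF Y μ (R + Complex.I * y) * fourierExt f (y - Complex.I * R)
    with hH
  -- The modulus factors as `e^{RY}` times the modulus of the transform, both integrable, so Fubini
  -- applies.
  have hprod : Integrable (Function.uncurry fun (ω : Ω) (y : ℝ) =>
      Complex.exp ((R + Complex.I * y) * Y ω) * fourierExt f (y - Complex.I * R))
      (μ.prod volume) := by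
    refine (hint.mul_prod (integrable_fourierExt hf hfc hC).norm).mono'
      (Measurable.aestronglyMeasurable ?_) (ae_of_all _ fun z => ?_)
    · refine Measurable.mul ?_ ((continuous_fourierExt hf hfc R).measurable.comp measurable_snd)
      have h1 : Measurable fun z : Ω × ℝ => ((Y z.1 : ℝ) : ℂ) :=
        Complex.measurable_ofReal.comp (hY.comp measurable_fst)
      have h2 : Measurable fun z : Ω × ℝ => (R + Complex.I * (z.2 : ℂ)) := by fun_prop
      exact Complex.measurable_exp.comp (h2.mul h1)
    · simp [Function.uncurry, Complex.norm_exp]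
  have hHint : Integrable H := by
    refine hprod.integral_prod_right.congr (ae_of_all _ fun y => ?_)
    simp only [Function.uncurry, hH, complexMGF]
    exact integral_mul_const _ _
  have hval : ((∫ ω, f (Y ω) ∂μ : ℝ) : ℂ) = 1 / (2 * Real.pi) * ∫ y, H y := by
    rw [← integral_complex_ofReal]
    simp_rw [eq_integral_fourierExt hf hfc hC]
    rw [integral_const_mul, integral_integral_swap hprod]
    congr 1
    refine integral_congr_ae (ae_of_all _ fun y => ?_)
    simp only [hH, complexMGF]
    exact integral_mul_const _ _
  have hre : ∫ ω, f (Y ω) ∂μ = 1 / (2 * Real.pi) * ∫ y, (H y).re := by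
    have h1 := congrArg Complex.re hval
    rw [Complex.ofReal_re] at h1
    rw [h1, show (1 / (2 * Real.pi) : ℂ) = ((1 / (2 * Real.pi) : ℝ) : ℂ) by push_cast; rfl,
      Complex.re_ofReal_mul]
    congr 1
    exact (integral_re hHint).symm
  -- As `f` and `Y` are real, `H(-y)` is the conjugate of `H(y)`; the even real part reduces the
  -- integral to the half-line.
  have heven : ∀ y : ℝ, (H |y|).re = (H y).re := by
    intro y
    rcases abs_choice y with h | h
    · rw [h]
    · rw [h]
      have : H (-y) = (starRingEnd ℂ) (H y) := by
        simp only [hH]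
        rw [map_mul, conj_complexMGF, conj_fourierExt]
      rw [this, Complex.conj_re]
  refine ⟨hHint.integrableOn, ?_⟩
  rw [hre, ← integral_congr_ae (ae_of_all _ heven), integral_comp_abs (f := fun y => (H y).re)]
  ring

end Inversion

/-! ### Combinations of the functions `M^v` -/

section Comb

variable {φ ψ : ℝ≥0 → ℝ → ℝ} {T t : ℝ≥0} {κ₁ κ₂ : ℝ}

lemma continuous_coshFun (φ ψ : ℝ≥0 → ℝ → ℝ) (T t : ℝ≥0) (v : ℝ) :
    Continuous (coshFun φ ψ T t v) := by
  unfold coshFun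
  fun_prop

lemma coshFun_pos (φ ψ : ℝ≥0 → ℝ → ℝ) (T t : ℝ≥0) (v x : ℝ) : 0 < coshFun φ ψ T t v x := by
  unfold coshFun
  positivity

/-- A linear combination of the functions `M_t^{u_k}`. -/
def coshComb (φ ψ : ℝ≥0 → ℝ → ℝ) (T t : ℝ≥0) (u : ℕ → ℝ) (J : Finset ℕ) (w : ℕ → ℝ) (x : ℝ) : ℝ :=
  ∑ k ∈ J, w k * coshFun φ ψ T t (u k) x

/-- This is integration by parts: `hFun` is the integral of `e^{sx}` against the derivative of
`M^v`. -/
lemma integral_exp_mul_coshFun {s : ℂ} {v : ℝ} (h1 : s + ψ (T - t) v ≠ 0)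
    (h2 : s + ψ (T - t) (-v) ≠ 0) :
    s * ∫ x in κ₁..κ₂, Complex.exp (s * x) * (coshFun φ ψ T t v x : ℂ)
      = Complex.exp (s * κ₂) * (coshFun φ ψ T t v κ₂ : ℂ)
        - Complex.exp (s * κ₁) * (coshFun φ ψ T t v κ₁ : ℂ) - hFun φ ψ T t κ₁ κ₂ s v := by
  have key : ∀ x : ℝ, Complex.exp (s * x) * (coshFun φ ψ T t v x : ℂ)
      = Complex.exp (φ (T - t) v) / 2 * Complex.exp ((s + ψ (T - t) v) * x)
        + Complex.exp (φ (T - t) (-v)) / 2 * Complex.exp ((s + ψ (T - t) (-v)) * x) := by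
    intro x
    simp only [coshFun]
    push_cast
    simp only [add_mul, Complex.exp_add]
    ring
  simp_rw [key]
  rw [intervalIntegral.integral_add (Continuous.intervalIntegrable (by fun_prop) _ _)
    (Continuous.intervalIntegrable (by fun_prop) _ _), intervalIntegral.integral_const_mul,
    intervalIntegral.integral_const_mul, integral_exp_mul_complex h1, integral_exp_mul_complex h2,
    hFun]
  field_simp
  ring

/-- The Fourier transform of a combination of the `M^v`, cut off at two of its roots. -/
lemma fourierExt_coshComb {u : ℕ → ℝ} {J : Finset ℕ} {w : ℕ → ℝ} (hκ : κ₁ ≤ κ₂)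
    (hroot : κ₁ = κ₂ ∨ coshComb φ ψ T t u J w κ₁ = 0 ∧ coshComb φ ψ T t u J w κ₂ = 0)
    {z : ℂ} (hz : z ≠ 0) (hne : ∀ j ∈ J, -Complex.I * z + ψ (T - t) (u j) ≠ 0 ∧
      -Complex.I * z + ψ (T - t) (-u j) ≠ 0) :
    fourierExt ((Ioo κ₁ κ₂).indicator (coshComb φ ψ T t u J w)) z
      = 1 / (Complex.I * z) * ∑ k ∈ J, w k * hFun φ ψ T t κ₁ κ₂ (-Complex.I * z) (u k) := by
  set s := -Complex.I * z with hs
  have hs0 : s ≠ 0 := mul_ne_zero (neg_ne_zero.2 Complex.I_ne_zero) hz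
  have h1 : fourierExt ((Ioo κ₁ κ₂).indicator (coshComb φ ψ T t u J w)) z
      = ∑ k ∈ J, w k * ∫ x in κ₁..κ₂, Complex.exp (s * x) * (coshFun φ ψ T t (u k) x : ℂ) := by
    have hind : ∀ x : ℝ, Complex.exp (-Complex.I * z * x) *
        (((Ioo κ₁ κ₂).indicator (coshComb φ ψ T t u J w) x : ℝ) : ℂ)
        = (Ioo κ₁ κ₂).indicator (fun x : ℝ => ∑ k ∈ J, (w k : ℂ) * (Complex.exp (s * x) *
            (coshFun φ ψ T t (u k) x : ℂ))) x := by
      intro x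
      by_cases hx : x ∈ Ioo κ₁ κ₂
      · rw [indicator_of_mem hx, indicator_of_mem hx, coshComb, ← hs]
        push_cast
        rw [Finset.mul_sum]
        exact Finset.sum_congr rfl fun k _ => by ring
      · simp [indicator_of_notMem hx]
    rw [fourierExt]
    simp_rw [hind]
    rw [integral_indicator measurableSet_Ioo, ← integral_Ioc_eq_integral_Ioo,
      ← intervalIntegral.integral_of_le hκ, intervalIntegral.integral_finsetSum]
    · simp_rw [intervalIntegral.integral_const_mul]
    · intro k _
      have := continuous_coshFun φ ψ T t (u k)
      exact Continuous.intervalIntegrable (by fun_prop) _ _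
  have h2 : ∑ k ∈ J, w k * (Complex.exp (s * κ₂) * (coshFun φ ψ T t (u k) κ₂ : ℂ)
        - Complex.exp (s * κ₁) * (coshFun φ ψ T t (u k) κ₁ : ℂ))
      = Complex.exp (s * κ₂) * (coshComb φ ψ T t u J w κ₂ : ℂ)
        - Complex.exp (s * κ₁) * (coshComb φ ψ T t u J w κ₁ : ℂ) := by
    simp only [coshComb]
    push_cast
    rw [Finset.mul_sum, Finset.mul_sum, ← Finset.sum_sub_distrib]
    exact Finset.sum_congr rfl fun k _ => by ring
  have h3 : Complex.exp (s * κ₂) * (coshComb φ ψ T t u J w κ₂ : ℂ)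
        - Complex.exp (s * κ₁) * (coshComb φ ψ T t u J w κ₁ : ℂ) = 0 := by
    rcases hroot with h | ⟨ha, hb⟩
    · rw [h, sub_self]
    · simp [ha, hb]
  have h4 : s * fourierExt ((Ioo κ₁ κ₂).indicator (coshComb φ ψ T t u J w)) z
      = -∑ k ∈ J, w k * hFun φ ψ T t κ₁ κ₂ s (u k) := by
    rw [h1, Finset.mul_sum, ← sub_eq_zero, sub_neg_eq_add, ← Finset.sum_add_distrib, ← h3, ← h2]
    refine Finset.sum_congr rfl fun k hk => ?_
    have := integral_exp_mul_coshFun (κ₁ := κ₁) (κ₂ := κ₂) (φ := φ) (hne k hk).1 (hne k hk).2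
    linear_combination (w k : ℂ) * this
  have hIz : Complex.I * z ≠ 0 := mul_ne_zero Complex.I_ne_zero hz
  rw [one_div, eq_inv_mul_iff_mul_eq₀ hIz]
  rw [hs] at h4 ⊢
  linear_combination -h4

lemma neg_I_mul_add_ne_zero {y : ℝ} (hy : y ≠ 0) (R a : ℝ) :
    -Complex.I * (y - Complex.I * R) + a ≠ 0 := by
  intro h
  have := congrArg Complex.im h
  simp at this
  exact hy this

/-- The denominator has imaginary part of modulus `|y|` (up to the factor `2`), while the moduli of
the exponentials do not depend on `y`. This bounds one summand of `hFun`. -/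
lemma norm_exp_quotient_le {y : ℝ} (hy : y ≠ 0) (R a : ℝ) (κ₁ κ₂ b : ℝ) :
    ‖Complex.exp b * (a / (2 * (-Complex.I * (y - Complex.I * R) + a)))
      * (Complex.exp ((-Complex.I * (y - Complex.I * R) + a) * κ₂)
        - Complex.exp ((-Complex.I * (y - Complex.I * R) + a) * κ₁))‖
      ≤ Real.exp b * |a| * (Real.exp ((a - R) * κ₂) + Real.exp ((a - R) * κ₁)) * |y|⁻¹ := by
  set d : ℂ := -Complex.I * (y - Complex.I * R) + a with hd
  have hre : d.re = a - R := by simp [hd]; ring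
  have him : d.im = -y := by simp [hd]
  have hyd : |y| ≤ ‖d‖ := by
    have := Complex.abs_im_le_norm d
    rwa [him, abs_neg] at this
  have hy0 : 0 < |y| := abs_pos.2 hy
  have hnorm : ∀ κ : ℝ, ‖Complex.exp (d * κ)‖ = Real.exp ((a - R) * κ) := by
    intro κ
    rw [Complex.norm_exp, Complex.re_mul_ofReal, hre]
  rw [norm_mul, norm_mul, norm_div, norm_mul, Complex.norm_exp, Complex.ofReal_re,
    Complex.norm_real, Real.norm_eq_abs, Complex.norm_ofNat]
  have h1 : |a| / (2 * ‖d‖) ≤ |a| * |y|⁻¹ := by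
    rw [div_eq_mul_inv]
    refine mul_le_mul_of_nonneg_left ?_ (abs_nonneg a)
    exact inv_anti₀ hy0 (by linarith)
  have h2 : ‖Complex.exp (d * κ₂) - Complex.exp (d * κ₁)‖
      ≤ Real.exp ((a - R) * κ₂) + Real.exp ((a - R) * κ₁) := by
    rw [← hnorm, ← hnorm]
    exact norm_sub_le _ _
  calc Real.exp b * (|a| / (2 * ‖d‖)) * ‖Complex.exp (d * κ₂) - Complex.exp (d * κ₁)‖
      ≤ Real.exp b * (|a| * |y|⁻¹) * (Real.exp ((a - R) * κ₂) + Real.exp ((a - R) * κ₁)) := by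
        gcongr
    _ = _ := by ring

lemma exists_norm_hFun_le (φ ψ : ℝ≥0 → ℝ → ℝ) (T t : ℝ≥0) (κ₁ κ₂ R v : ℝ) :
    ∃ C : ℝ, ∀ y : ℝ, y ≠ 0 →
      ‖hFun φ ψ T t κ₁ κ₂ (-Complex.I * (y - Complex.I * R)) v‖ ≤ C * |y|⁻¹ := by
  refine ⟨_, fun y hy => (norm_add_le _ _).trans ((add_le_add
    (norm_exp_quotient_le hy R (ψ (T - t) v) κ₁ κ₂ (φ (T - t) v))
    (norm_exp_quotient_le hy R (ψ (T - t) (-v)) κ₁ κ₂ (φ (T - t) (-v)))).trans_eq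
    (add_mul _ _ _).symm)⟩

/-- One factor `|y|⁻¹` comes from `1 / (iz)` and one from `hFun`; the vanishing boundary terms are
what makes the second available. The damped `L¹` norm of the function supplies the remaining
constant, which also controls `y` near `0`. -/
lemma exists_norm_fourierExt_coshComb_le {u : ℕ → ℝ} {J : Finset ℕ} {w : ℕ → ℝ} (hκ : κ₁ ≤ κ₂)
    (hroot : κ₁ = κ₂ ∨ coshComb φ ψ T t u J w κ₁ = 0 ∧ coshComb φ ψ T t u J w κ₂ = 0) (R : ℝ) :
    ∃ C : ℝ, ∀ y : ℝ, ‖fourierExt ((Ioo κ₁ κ₂).indicator (coshComb φ ψ T t u J w))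
      (y - Complex.I * R)‖ ≤ C * (1 + y ^ 2)⁻¹ := by
  set f := (Ioo κ₁ κ₂).indicator (coshComb φ ψ T t u J w)
  choose C hC using fun k => exists_norm_hFun_le φ ψ T t κ₁ κ₂ R (u k)
  set C₀ := ∫ x : ℝ, ‖Real.exp (-(R * x)) * f x‖
  set C₁ := ∑ k ∈ J, |w k| * C k
  have hC₁ : ∀ y : ℝ, y ≠ 0 → ‖fourierExt f (y - Complex.I * R)‖ * y ^ 2 ≤ C₁ := by
    intro y hy
    have hy0 : 0 < |y| := abs_pos.2 hy
    have hzy : |y| ≤ ‖(y - Complex.I * R : ℂ)‖ := by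
      have := Complex.abs_re_le_norm (y - Complex.I * R : ℂ)
      simpa using this
    have hz : (y - Complex.I * R : ℂ) ≠ 0 := norm_pos_iff.1 (hy0.trans_le hzy)
    rw [fourierExt_coshComb hκ hroot hz fun j _ =>
      ⟨neg_I_mul_add_ne_zero hy R _, neg_I_mul_add_ne_zero hy R _⟩]
    rw [norm_mul, norm_div, norm_one, norm_mul, Complex.norm_I, one_mul, one_div]
    have hsum : ‖∑ k ∈ J, (w k : ℂ) * hFun φ ψ T t κ₁ κ₂ (-Complex.I * (y - Complex.I * R)) (u k)‖
        ≤ C₁ * |y|⁻¹ := by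
      refine (norm_sum_le _ _).trans ?_
      rw [Finset.sum_mul]
      refine Finset.sum_le_sum fun k _ => ?_
      rw [norm_mul, Complex.norm_real, Real.norm_eq_abs, mul_assoc]
      exact mul_le_mul_of_nonneg_left (hC k y hy) (abs_nonneg _)
    calc _ ≤ |y|⁻¹ * (C₁ * |y|⁻¹) * y ^ 2 := by
          refine mul_le_mul_of_nonneg_right ?_ (sq_nonneg y)
          exact mul_le_mul (inv_anti₀ hy0 hzy) hsum (norm_nonneg _) (by positivity)
      _ = C₁ := by
          rw [← sq_abs y]
          field_simp
  refine ⟨C₀ + C₁, fun y => ?_⟩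
  rw [← div_eq_mul_inv, le_div_iff₀ (by positivity), mul_add, mul_one]
  refine add_le_add (norm_fourierExt_le f R y) ?_
  by_cases hy : y = 0
  · have h1 := hC₁ 1 one_ne_zero
    rw [hy]
    have : 0 ≤ C₁ := le_trans (by positivity) h1
    simpa using this
  · exact hC₁ y hy

end Comb

/-! ### Exercise intervals for quotients of combinations of the `M^v` -/

section Quotient

variable {Ω : Type*} {mΩ : MeasurableSpace Ω} {D : Set ℝ} {𝓕 : Filtration ℝ≥0 mΩ}
  {X : ℝ≥0 → Ω → D} {P : Kernel D Ω} [IsMarkovKernel P] {T t : ℝ≥0} {φ ψ : ℝ≥0 → ℝ → ℝ}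

lemma neg_mem_of_le {I : Set ℝ} (hI : OrdConnected I) {v m : ℝ} (hv : v ∈ I) (hv' : -v ∈ I)
    (h0 : 0 ≤ m) (hm : m ≤ v) : m ∈ I ∧ -m ∈ I :=
  ⟨hI.out hv' hv ⟨by linarith, hm⟩, hI.out hv' hv ⟨by linarith, by linarith⟩⟩

/-- From `-v < -m ≤ ±u j ≤ m < v` and strict monotonicity of `ψ`, the exponents `ψ(±v)` strictly
enclose all those of the denominator, with `ψ(-m)` and `ψ(m)` as separating values. -/
lemma IsExponentPair.exists_quotient (hφψ : IsExponentPair X P T φ ψ)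
    (hX : IsAnalyticAffine 𝓕 X P T) {u : ℕ → ℝ} {J : Finset ℕ} {c : ℕ → ℝ} {v m : ℝ}
    (hv : v ∈ realMomentSet X P T) (hv' : -v ∈ realMomentSet X P T) (hmv : m < v)
    (hu : ∀ j ∈ J, 0 ≤ u j ∧ u j ≤ m) (hc : ∀ j ∈ J, 0 ≤ c j) (hc' : ∃ j ∈ J, 0 < c j) :
    (∃ ξ, StrictAntiOn (fun x => coshFun φ ψ T t v x / coshComb φ ψ T t u J c x) (Iic ξ) ∧
      StrictMonoOn (fun x => coshFun φ ψ T t v x / coshComb φ ψ T t u J c x) (Ici ξ)) ∧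
    Tendsto (fun x => coshFun φ ψ T t v x / coshComb φ ψ T t u J c x) atTop atTop ∧
    Tendsto (fun x => coshFun φ ψ T t v x / coshComb φ ψ T t u J c x) atBot atTop := by
  have hmono := hφψ.strictMonoOn hX (t := T - t) tsub_le_self
  have hI := ordConnected_realMomentSet hX.isMarkov
  set I := realMomentSet X P T
  have hm0 : 0 ≤ m := by
    obtain ⟨j, hj, -⟩ := hc'
    exact (hu j hj).1.trans (hu j hj).2
  obtain ⟨hm, hm'⟩ := neg_mem_of_le hI hv hv' hm0 hmv.le
  -- Each `M^{u_j}` consists of two exponentials; the Boolean selects the sign.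
  let a : ℕ × Bool → ℝ := fun i => ψ (T - t) (if i.2 then u i.1 else -u i.1)
  let d : ℕ × Bool → ℝ := fun i =>
    c i.1 * (Real.exp (φ (T - t) (if i.2 then u i.1 else -u i.1)) / 2)
  have hsum : ∀ x, coshComb φ ψ T t u J c x
      = ∑ i ∈ J ×ˢ Finset.univ, d i * Real.exp (a i * x) := by
    intro x
    rw [Finset.sum_product]
    refine Finset.sum_congr rfl fun k _ => ?_
    simp only [coshFun, d, a, Fintype.sum_bool, if_true, Real.exp_add]
    simp
    ring
  have hnum : ∀ x, coshFun φ ψ T t v x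
      = Real.exp (φ (T - t) v) / 2 * Real.exp (ψ (T - t) v * x)
        + Real.exp (φ (T - t) (-v)) / 2 * Real.exp (ψ (T - t) (-v) * x) := by
    intro x
    simp only [coshFun, Real.exp_add]
    ring
  simp_rw [hsum, hnum]
  have hd : ∀ i ∈ J ×ˢ Finset.univ, 0 ≤ d i := by
    intro i hi
    exact mul_nonneg (hc _ (Finset.mem_product.1 hi).1) (by positivity)
  have hd' : ∃ i ∈ J ×ˢ Finset.univ, 0 < d i := by
    obtain ⟨j, hj, hcj⟩ := hc'
    exact ⟨(j, true), Finset.mem_product.2 ⟨hj, Finset.mem_univ _⟩,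
      mul_pos hcj (by positivity)⟩
  have ha : ∀ i ∈ J ×ˢ Finset.univ, ψ (T - t) (-m) ≤ a i ∧ a i ≤ ψ (T - t) m := by
    rintro ⟨j, b⟩ hi
    obtain ⟨h0, h1⟩ := hu j (Finset.mem_product.1 hi).1
    obtain ⟨hj, hj'⟩ := neg_mem_of_le hI hm hm' h0 h1
    have e1 : -m ≤ -u j := by linarith
    have e2 : -m ≤ u j := by linarith
    cases b
    · exact ⟨hmono.monotoneOn hm' hj' e1, hmono.monotoneOn hj' hm (by linarith : -u j ≤ m)⟩
    · exact ⟨hmono.monotoneOn hm' hj e2, hmono.monotoneOn hj hm h1⟩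
  have hα : 0 < Real.exp (φ (T - t) v) / 2 := by positivity
  have hβ : 0 < Real.exp (φ (T - t) (-v)) / 2 := by positivity
  have hq : ψ (T - t) (-v) < ψ (T - t) (-m) := hmono hv' hm' (neg_lt_neg hmv)
  have hp : ψ (T - t) m < ψ (T - t) v := hmono hm hv hmv
  exact ⟨exists_strictAntiOn_strictMonoOn hα hβ hq hp hd hd' ha,
    tendsto_expSum_quotient_atTop hα hβ hp hd hd' fun i hi => (ha i hi).2,
    tendsto_expSum_quotient_atBot hα hβ hq hd hd' fun i hi => (ha i hi).1⟩

lemma continuous_coshComb (φ ψ : ℝ≥0 → ℝ → ℝ) (T t : ℝ≥0) (u : ℕ → ℝ) (J : Finset ℕ)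
    (w : ℕ → ℝ) : Continuous (coshComb φ ψ T t u J w) :=
  continuous_finsetSum _ fun _ _ => continuous_const.mul (continuous_coshFun _ _ _ _ _)

lemma coshComb_pos {u : ℕ → ℝ} {J : Finset ℕ} {c : ℕ → ℝ} (hc : ∀ j ∈ J, 0 ≤ c j)
    (hc' : ∃ j ∈ J, 0 < c j) (x : ℝ) : 0 < coshComb φ ψ T t u J c x := by
  obtain ⟨j, hj, hcj⟩ := hc'
  exact Finset.sum_pos' (fun i hi => mul_nonneg (hc i hi) (coshFun_pos _ _ _ _ _ _).le)
    ⟨j, hj, mul_pos hcj (coshFun_pos _ _ _ _ _ _)⟩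

/-- Both `b - M^v / G` and `G / M^v - 1` have a unique exercise interval, for
`G = ∑ c_j M^{u_j}` with `0 ≤ u_j < v` and nonnegative weights `c_j`. -/
lemma IsExponentPair.existsUnique_isPayoffInterval (hφψ : IsExponentPair X P T φ ψ)
    (hX : IsAnalyticAffine 𝓕 X P T) {u : ℕ → ℝ} {J : Finset ℕ} {c : ℕ → ℝ} {v m : ℝ}
    (hv : v ∈ realMomentSet X P T) (hv' : -v ∈ realMomentSet X P T) (hmv : m < v)
    (hu : ∀ j ∈ J, 0 ≤ u j ∧ u j ≤ m) (hc : ∀ j ∈ J, 0 ≤ c j) (hc' : ∃ j ∈ J, 0 < c j) :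
    (∀ b : ℝ, ∃! κ : ℝ × ℝ, IsPayoffInterval
      (fun x => b - coshFun φ ψ T t v x / coshComb φ ψ T t u J c x) κ.1 κ.2) ∧
    ∃! κ : ℝ × ℝ, IsPayoffInterval
      (fun x => coshComb φ ψ T t u J c x / coshFun φ ψ T t v x - 1) κ.1 κ.2 := by
  obtain ⟨⟨ξ, hanti, hmono⟩, htop, hbot⟩ := hφψ.exists_quotient (t := t) hX hv hv' hmv hu hc hc'
  have hG := coshComb_pos (φ := φ) (ψ := ψ) (T := T) (t := t) (u := u) hc hc'
  have hM := coshFun_pos φ ψ T t v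
  have hcG := continuous_coshComb φ ψ T t u J c
  have hcM := continuous_coshFun φ ψ T t v
  have hl : ∀ b : ℝ, ∃ x ≤ ξ, b < coshFun φ ψ T t v x / coshComb φ ψ T t u J c x := fun b =>
    ((eventually_le_atBot ξ).and (hbot.eventually_gt_atTop b)).exists
  have hr : ∀ b : ℝ, ∃ x, ξ ≤ x ∧ b < coshFun φ ψ T t v x / coshComb φ ψ T t u J c x := fun b =>
    ((eventually_ge_atTop ξ).and (htop.eventually_gt_atTop b)).exists
  -- The swaption quotient is the reciprocal of the floorlet one, so its monotonicity is reversed.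
  have hinv : ∀ x, coshComb φ ψ T t u J c x / coshFun φ ψ T t v x
      = (coshFun φ ψ T t v x / coshComb φ ψ T t u J c x)⁻¹ := fun x => (inv_div _ _).symm
  have hQ : ∀ x, 0 < coshFun φ ψ T t v x / coshComb φ ψ T t u J c x :=
    fun x => div_pos (hM x) (hG x)
  constructor
  · intro b
    refine AffineLibor.existsUnique_isPayoffInterval (ξ := ξ)
      (continuous_const.sub (hcM.div hcG fun x => (hG x).ne')) ?_ ?_ ?_ ?_
    · intro x hx y hy hxy
      have := hanti hx hy hxy
      simp only at this ⊢
      linarith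
    · intro x hx y hy hxy
      have := hmono hx hy hxy
      simp only at this ⊢
      linarith
    · obtain ⟨x, hx, h⟩ := hl b
      exact ⟨x, hx, by linarith⟩
    · obtain ⟨x, hx, h⟩ := hr b
      exact ⟨x, hx, by linarith⟩
  · refine AffineLibor.existsUnique_isPayoffInterval (ξ := ξ)
      ((hcG.div hcM fun x => (hM x).ne').sub continuous_const) ?_ ?_ ?_ ?_
    · intro x hx y hy hxy
      have := inv_strictAnti₀ (hQ y) (hanti hx hy hxy)
      simp only [hinv]
      linarith
    · intro x hx y hy hxy
      have := inv_strictAnti₀ (hQ x) (hmono hx hy hxy)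
      simp only [hinv]
      linarith
    · obtain ⟨x, hx, h⟩ := hl 1
      have := inv_lt_one_of_one_lt₀ h
      exact ⟨x, hx, by simp only [hinv]; linarith⟩
    · obtain ⟨x, hx, h⟩ := hr 1
      have := inv_lt_one_of_one_lt₀ h
      exact ⟨x, hx, by simp only [hinv]; linarith⟩

end Quotient

/-! ### Change of measure -/

/-- The abstract Bayes formula. -/
lemma condExp_withDensity_mul_condExp {Ω : Type*} {m mΩ : MeasurableSpace Ω} (hm : m ≤ mΩ)
    {μ : Measure Ω} [IsFiniteMeasure μ] {Z W : Ω → ℝ} (hZ : Integrable Z μ) (hZ0 : ∀ ω, 0 ≤ Z ω)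
    (hWZ : Integrable (fun ω => W ω * Z ω) μ) :
    (fun ω => ((μ.withDensity fun ω => ENNReal.ofReal (Z ω))[W | m]) ω * (μ[Z | m]) ω)
      =ᵐ[μ] μ[fun ω => W ω * Z ω | m] := by
  set ν := μ.withDensity fun ω => ENNReal.ofReal (Z ω) with hν
  have hνfin : IsFiniteMeasure ν := isFiniteMeasure_withDensity_ofReal hZ.2
  have hZm : AEMeasurable (fun ω => ENNReal.ofReal (Z ω)) μ := hZ.1.aemeasurable.ennreal_ofReal
  have hfin : ∀ᵐ ω ∂μ, ENNReal.ofReal (Z ω) < ∞ := ae_of_all _ fun _ => ENNReal.ofReal_lt_top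
  have hsmul : ∀ (V : Ω → ℝ) ω, (ENNReal.ofReal (Z ω)).toReal • V ω = V ω * Z ω := fun V ω => by
    rw [ENNReal.toReal_ofReal (hZ0 ω), smul_eq_mul, mul_comm]
  have hint : ∀ V : Ω → ℝ, Integrable V ν ↔ Integrable (fun ω => V ω * Z ω) μ := by
    intro V
    rw [hν, integrable_withDensity_iff_integrable_smul₀' hZm hfin]
    simp_rw [hsmul]
  have hset : ∀ (V : Ω → ℝ) (s : Set Ω), MeasurableSet s →
      ∫ ω in s, V ω ∂ν = ∫ ω in s, V ω * Z ω ∂μ := by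
    intro V s hs
    rw [hν, restrict_withDensity hs, integral_withDensity_eq_integral_toReal_smul₀
      hZm.restrict (ae_restrict_of_ae hfin)]
    simp_rw [hsmul]
  have hC : Integrable (fun ω => (ν[W | m]) ω * Z ω) μ := (hint _).1 integrable_condExp
  have h1 : μ[fun ω => (ν[W | m]) ω * Z ω | m] =ᵐ[μ] fun ω => (ν[W | m]) ω * (μ[Z | m]) ω :=
    condExp_mul_of_stronglyMeasurable_left stronglyMeasurable_condExp hC hZ
  refine h1.symm.trans ?_
  refine ae_eq_condExp_of_forall_setIntegral_eq hm hWZ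
    (fun s _ _ => integrable_condExp.integrableOn) (fun s hs _ => ?_)
    stronglyMeasurable_condExp.aestronglyMeasurable
  -- Over an event of `m` both sides become integrals under the new measure, where the defining
  -- property of `ν[W | m]` applies.
  rw [setIntegral_condExp hm hC hs, ← hset _ s (hm s hs), ← hset _ s (hm s hs),
    setIntegral_condExp hm ((hint W).2 hWZ) hs]

/-! ### Prices in the modified affine LIBOR model -/

section Cosh

variable {Ω : Type*} {mΩ : MeasurableSpace Ω} {D : Set ℝ} {𝓕 : Filtration ℝ≥0 mΩ}
  {X : ℝ≥0 → Ω → D} {P : Kernel D Ω} {T : ℝ≥0} {φ ψ : ℝ≥0 → ℝ → ℝ}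

lemma integrable_cosh (hX : IsHomogeneousMarkov 𝓕 X P T) {t : ℝ≥0} (ht : t ≤ T) {v : ℝ}
    (hv : v ∈ realMomentSet X P T) (hv' : -v ∈ realMomentSet X P T) (x : D) :
    Integrable (fun ω => Real.cosh (v * (X t ω : ℝ))) (P x) := by
  simp_rw [Real.cosh_eq, ← neg_mul]
  exact ((integrable_real_exp hX ht hv x).add (integrable_real_exp hX ht hv' x)).div_const 2

lemma IsExponentPair.integral_cosh (hφψ : IsExponentPair X P T φ ψ)
    (hX : IsHomogeneousMarkov 𝓕 X P T) {t : ℝ≥0} {v : ℝ}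
    (hv : v ∈ realMomentSet X P T) (hv' : -v ∈ realMomentSet X P T) (x : D) :
    ∫ ω, Real.cosh (v * (X (T - t) ω : ℝ)) ∂(P x) = coshFun φ ψ T t v x := by
  simp_rw [Real.cosh_eq, ← neg_mul]
  rw [integral_div, integral_add (integrable_real_exp hX tsub_le_self hv x)
    (integrable_real_exp hX tsub_le_self hv' x), hφψ _ tsub_le_self v hv,
    hφψ _ tsub_le_self (-v) hv', coshFun]

variable [IsMarkovKernel P]

lemma IsExponentPair.condExp_cosh (hφψ : IsExponentPair X P T φ ψ)
    (hX : IsHomogeneousMarkov 𝓕 X P T) {t : ℝ≥0} (ht : t ≤ T) {v : ℝ}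
    (hv : v ∈ realMomentSet X P T) (hv' : -v ∈ realMomentSet X P T) (x : D) :
    (P x)[fun ω => Real.cosh (v * (X T ω : ℝ)) | 𝓕 t]
      =ᵐ[P x] fun ω => coshFun φ ψ T t v (X t ω) := by
  have hc : Continuous fun y : D => Real.cosh (v * y) := by fun_prop
  refine (hX.condExp_comp_of_le x ht le_rfl (f := fun y : D => Real.cosh (v * y))
    hc.stronglyMeasurable (integrable_cosh hX le_rfl hv hv' x)).trans (ae_of_all _ fun ω => ?_)
  exact hφψ.integral_cosh hX hv hv' _

lemma IsExponentPair.integrable_coshFun (hφψ : IsExponentPair X P T φ ψ)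
    (hX : IsHomogeneousMarkov 𝓕 X P T) {t : ℝ≥0} (ht : t ≤ T) {v : ℝ}
    (hv : v ∈ realMomentSet X P T) (hv' : -v ∈ realMomentSet X P T) (x : D) :
    Integrable (fun ω => coshFun φ ψ T t v (X t ω)) (P x) :=
  integrable_condExp.congr (hφψ.condExp_cosh hX ht hv hv' x)

/-- The process `M_t^v(X_t)` is a martingale. -/
lemma IsExponentPair.condExp_coshFun (hφψ : IsExponentPair X P T φ ψ)
    (hX : IsHomogeneousMarkov 𝓕 X P T) {s t : ℝ≥0} (hst : s ≤ t) (ht : t ≤ T) {v : ℝ}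
    (hv : v ∈ realMomentSet X P T) (hv' : -v ∈ realMomentSet X P T) (x : D) :
    (P x)[fun ω => coshFun φ ψ T t v (X t ω) | 𝓕 s]
      =ᵐ[P x] fun ω => coshFun φ ψ T s v (X s ω) :=
  (condExp_congr_ae (hφψ.condExp_cosh hX ht hv hv' x).symm).trans
    ((condExp_condExp_of_le (𝓕.mono hst) (𝓕.le t)).trans
      (hφψ.condExp_cosh hX (hst.trans ht) hv hv' x))

lemma IsExponentPair.coshFun_zero (hφψ : IsExponentPair X P T φ ψ) (hX : IsAnalyticAffine 𝓕 X P T)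
    (t : ℝ≥0) (x : ℝ) : coshFun φ ψ T t 0 x = 1 := by
  simp [coshFun, hφψ.apply_zero hX (tsub_le_self : T - t ≤ T)]

lemma IsExponentPair.coshFun_self (hφψ : IsExponentPair X P T φ ψ) (hX : IsAnalyticAffine 𝓕 X P T)
    {v : ℝ} (hv : v ∈ realMomentSet X P T) (hv' : -v ∈ realMomentSet X P T) (x : ℝ) :
    coshFun φ ψ T T v x = Real.cosh (v * x) := by
  simp [coshFun, hφψ.time_zero hX hv, hφψ.time_zero hX hv', Real.cosh_eq]

end Cosh

section Market

variable {Ω : Type*} {mΩ : MeasurableSpace Ω} {D : Set ℝ} {𝓕 : Filtration ℝ≥0 mΩ}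
  {X : ℝ≥0 → Ω → D} {P : Kernel D Ω} [IsMarkovKernel P] {x₀ : D} {N : ℕ} {τ : ℕ → ℝ≥0}
  {u : ℕ → ℝ} {B : ℕ → ℝ≥0 → Ω → ℝ} {φ ψ : ℝ≥0 → ℝ → ℝ} {T : ℝ≥0}

lemma IsModifiedAffineLibor.tenor_mono {Q : Measure Ω} {V : Set ℂ}
    (hB : IsModifiedAffineLibor 𝓕 X Q V N τ u B) {j k : ℕ} (hj : 1 ≤ j) (hjk : j ≤ k)
    (hk : k ≤ N + 1) : τ j ≤ τ k := by
  have hmono := hB.tenor_lt.monotoneOn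
  rcases hk.eq_or_lt with rfl | hlt
  · rcases hjk.eq_or_lt with rfl | hlt'
    · exact le_rfl
    · exact (hmono ⟨hj, by omega⟩ ⟨hB.one_le, le_rfl⟩ (by omega)).trans hB.tenor_last
  · exact hmono ⟨hj, by omega⟩ ⟨by omega, by omega⟩ hjk

lemma IsModifiedAffineLibor.accrual_nonneg {Q : Measure Ω} {V : Set ℂ}
    (hB : IsModifiedAffineLibor 𝓕 X Q V N τ u B) {k : ℕ} (hk : 1 ≤ k) (hkN : k ≤ N) :
    0 ≤ accrual τ (k + 1) :=
  sub_nonneg.2 (NNReal.coe_le_coe.2 (hB.tenor_mono hk (Nat.le_succ k) (by omega)))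

lemma IsModifiedAffineLibor.accrual_pos {Q : Measure Ω} {V : Set ℂ}
    (hB : IsModifiedAffineLibor 𝓕 X Q V N τ u B) {k : ℕ} (hk : 2 ≤ k) (hkN : k ≤ N) :
    0 < accrual τ k :=
  sub_pos.2 (NNReal.coe_lt_coe.2 (hB.tenor_lt ⟨by omega, by omega⟩ ⟨by omega, hkN⟩ (by omega)))

lemma IsModifiedAffineLibor.mem (hB : IsModifiedAffineLibor 𝓕 X (P x₀) (momentSet X P T) N τ u B)
    {k : ℕ} (hk : k ∈ Icc 1 (N + 1)) :
    u k ∈ realMomentSet X P T ∧ -u k ∈ realMomentSet X P T := by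
  rcases hk.2.eq_or_lt with rfl | hlt
  · have h0 : (0 : ℝ) ∈ realMomentSet X P T := by
      simpa [realMomentSet] using zero_mem_momentSet (X := X) (P := P) (T := T)
    rw [hB.u_last]
    simpa using h0
  · have hk' : k ∈ Icc 1 N := ⟨hk.1, by omega⟩
    exact ⟨hB.u_mem k hk', by simpa [realMomentSet] using hB.neg_u_mem k hk'⟩

/-- Since `u (N + 1) = 0` and `M^0 = 1`, the numeraire bond is covered too, so later arguments need
no separate case. -/
lemma IsModifiedAffineLibor.ratio
    (hB : IsModifiedAffineLibor 𝓕 X (P x₀) (momentSet X P (τ (N + 1))) N τ u B)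
    (hX : IsAnalyticAffine 𝓕 X P (τ (N + 1))) (hφψ : IsExponentPair X P (τ (N + 1)) φ ψ) {k : ℕ}
    (hk : k ∈ Icc 1 (N + 1)) {t : ℝ≥0} (ht : t ≤ τ k) :
    (fun ω => B k t ω / B (N + 1) t ω)
      =ᵐ[P x₀] fun ω => coshFun φ ψ (τ (N + 1)) t (u k) (X t ω) := by
  have htT : t ≤ τ (N + 1) := ht.trans (hB.tenor_mono hk.1 hk.2 le_rfl)
  rcases hk.2.eq_or_lt with rfl | hlt
  · filter_upwards [hB.numeraire_pos t ht] with ω hω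
    rw [hB.u_last, hφψ.coshFun_zero hX, div_self hω.ne']
  · exact (hB.bond_ratio k ⟨hk.1, by omega⟩ t ht).trans
      (hφψ.condExp_cosh hX.isMarkov htT (hB.mem hk).1 (hB.mem hk).2 x₀)

/-- This version of the density is nonnegative at every `ω`, as the Bayes formula requires, and is a
martingale evaluated at `τ k`, divided by its initial value. -/
lemma IsModifiedAffineLibor.forwardMeasure_eq
    (hB : IsModifiedAffineLibor 𝓕 X (P x₀) (momentSet X P (τ (N + 1))) N τ u B)
    (hX : IsAnalyticAffine 𝓕 X P (τ (N + 1))) (hφψ : IsExponentPair X P (τ (N + 1)) φ ψ) {k : ℕ}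
    (hk : k ∈ Icc 1 (N + 1)) :
    forwardMeasure (P x₀) N τ B k = (P x₀).withDensity fun ω => ENNReal.ofReal
      (coshFun φ ψ (τ (N + 1)) (τ k) (u k) (X (τ k) ω) *
        (coshFun φ ψ (τ (N + 1)) 0 (u k) x₀)⁻¹) := by
  refine withDensity_congr_ae ?_
  filter_upwards [hB.ratio hX hφψ hk le_rfl, hB.ratio hX hφψ hk zero_le,
    hB.bond_maturity k hk, hX.isMarkov.initial x₀] with ω h1 h2 h3 h4
  rw [← h1, ← h4, ← h2, h3, inv_div]

lemma IsModifiedAffineLibor.isProbabilityMeasure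
    (hB : IsModifiedAffineLibor 𝓕 X (P x₀) (momentSet X P (τ (N + 1))) N τ u B)
    (hX : IsAnalyticAffine 𝓕 X P (τ (N + 1))) (hφψ : IsExponentPair X P (τ (N + 1)) φ ψ) {k : ℕ}
    (hk : k ∈ Icc 1 (N + 1)) : IsProbabilityMeasure (forwardMeasure (P x₀) N τ B k) := by
  have hkT : τ k ≤ τ (N + 1) := hB.tenor_mono hk.1 hk.2 le_rfl
  obtain ⟨hv, hv'⟩ := hB.mem hk
  have hpos := coshFun_pos φ ψ (τ (N + 1)) 0 (u k) x₀
  rw [hB.forwardMeasure_eq hX hφψ hk]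
  constructor
  rw [withDensity_apply _ MeasurableSet.univ, Measure.restrict_univ,
    ← ofReal_integral_eq_lintegral_ofReal
      ((hφψ.integrable_coshFun hX.isMarkov hkT hv hv' x₀).mul_const _)
      (ae_of_all _ fun ω => mul_nonneg (coshFun_pos _ _ _ _ _ _).le (inv_nonneg.2 hpos.le)),
    integral_mul_const, ← integral_congr_ae (hφψ.condExp_cosh hX.isMarkov hkT hv hv' x₀),
    integral_condExp (𝓕.le _)]
  have := hφψ.integral_cosh hX.isMarkov (t := 0) hv hv' x₀
  rw [tsub_zero] at this
  rw [this, mul_inv_cancel₀ hpos.ne', ENNReal.ofReal_one]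

/-- The price of a claim that pays `w(X_s)` under the forward measure. -/
lemma IsModifiedAffineLibor.price_eq
    (hB : IsModifiedAffineLibor 𝓕 X (P x₀) (momentSet X P (τ (N + 1))) N τ u B)
    (hX : IsAnalyticAffine 𝓕 X P (τ (N + 1))) (hφψ : IsExponentPair X P (τ (N + 1)) φ ψ) {k : ℕ}
    (hk : k ∈ Icc 1 (N + 1)) {s : ℝ≥0} (hs : s ≤ τ k) {w : ℝ → ℝ} (hw : Continuous w)
    (hwc : HasCompactSupport w) {W : Ω → ℝ} (hW : W =ᵐ[P x₀] fun ω => w (X s ω)) :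
    Integrable W (forwardMeasure (P x₀) N τ B k) ∧ ∀ t ≤ s,
      (fun ω => B k t ω * ((forwardMeasure (P x₀) N τ B k)[W | 𝓕 t]) ω) =ᵐ[P x₀] fun ω =>
        B (N + 1) t ω * ∫ ω', w (X (s - t) ω') *
          coshFun φ ψ (τ (N + 1)) s (u k) (X (s - t) ω') ∂(P (X t ω)) := by
  have hM := hX.isMarkov
  have hkT : τ k ≤ τ (N + 1) := hB.tenor_mono hk.1 hk.2 le_rfl
  have hsT : s ≤ τ (N + 1) := hs.trans hkT
  obtain ⟨hv, hv'⟩ := hB.mem hk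
  set T := τ (N + 1)
  set c := (coshFun φ ψ T 0 (u k) x₀)⁻¹
  have hc : 0 < c := inv_pos.2 (coshFun_pos _ _ _ _ _ _)
  set Y : Ω → ℝ := fun ω => coshFun φ ψ T (τ k) (u k) (X (τ k) ω)
  have hY : Integrable Y (P x₀) := hφψ.integrable_coshFun hM hkT hv hv' x₀
  have hYc : Integrable (fun ω => Y ω * c) (P x₀) := hY.mul_const c
  obtain ⟨K, hK⟩ := hwc.exists_bound_of_continuous hw
  have hwX : StronglyMeasurable[𝓕 s] fun ω => w (X s ω) :=
    ((hw.measurable.comp measurable_subtype_coe).comp (hM.adapted s hsT)).stronglyMeasurable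
  have hwY : Integrable (fun ω => w (X s ω) * Y ω) (P x₀) :=
    hY.bdd_mul (hwX.mono (𝓕.le s)).aestronglyMeasurable (ae_of_all _ fun ω => hK _)
  have hWY : (fun ω => w (X s ω) * Y ω * c) =ᵐ[P x₀] fun ω => W ω * (Y ω * c) := by
    filter_upwards [hW] with ω h
    rw [h, mul_assoc]
  have hWZ : Integrable (fun ω => W ω * (Y ω * c)) (P x₀) := (hwY.mul_const c).congr hWY
  have hZ0 : ∀ ω, 0 ≤ Y ω * c := fun ω => mul_nonneg (coshFun_pos _ _ _ _ _ _).le hc.le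
  rw [hB.forwardMeasure_eq hX hφψ hk]
  constructor
  · rw [integrable_withDensity_iff_integrable_smul₀' hYc.1.aemeasurable.ennreal_ofReal
      (ae_of_all _ fun _ => ENNReal.ofReal_lt_top)]
    refine hWZ.congr (ae_of_all _ fun ω => ?_)
    simp only
    rw [ENNReal.toReal_ofReal (hZ0 ω), smul_eq_mul, mul_comm]
  · intro t ht
    have hbayes := condExp_withDensity_mul_condExp (𝓕.le t) hYc hZ0 hWZ
    have h1 : (P x₀)[fun ω => Y ω * c | 𝓕 t]
        =ᵐ[P x₀] fun ω => coshFun φ ψ T t (u k) (X t ω) * c := by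
      have e : (fun ω => Y ω * c) = c • Y := by ext ω; simp [mul_comm]
      rw [e]
      refine (condExp_smul c Y (𝓕 t)).trans ?_
      filter_upwards [hφψ.condExp_coshFun hM (ht.trans hs) hkT hv hv' x₀] with ω h
      rw [Pi.smul_apply, h, smul_eq_mul, mul_comm]
    -- The payoff is known at `s`, possibly before `τ k` (as for floorlets), so it is pulled out and
    -- the martingale property moves the density down to `s`.
    have hpull : (P x₀)[fun ω => w (X s ω) * Y ω | 𝓕 s]
        =ᵐ[P x₀] fun ω => w (X s ω) * coshFun φ ψ T s (u k) (X s ω) := by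
      refine (condExp_mul_of_stronglyMeasurable_left hwX hwY hY).trans ?_
      filter_upwards [hφψ.condExp_coshFun hM hs hkT hv hv' x₀] with ω h
      rw [Pi.mul_apply, h]
    have hfc : Continuous fun y : D => w y * coshFun φ ψ T s (u k) y :=
      (hw.mul (continuous_coshFun φ ψ T s (u k))).comp continuous_subtype_val
    have h2 : (P x₀)[fun ω => w (X s ω) * Y ω | 𝓕 t]
        =ᵐ[P x₀] fun ω => ∫ ω', w (X (s - t) ω') *
          coshFun φ ψ T s (u k) (X (s - t) ω') ∂(P (X t ω)) :=
      (condExp_condExp_of_le (𝓕.mono ht) (𝓕.le s)).symm.trans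
        ((condExp_congr_ae hpull).trans (hM.condExp_comp_of_le x₀ ht hsT
          (f := fun y : D => w y * coshFun φ ψ T s (u k) y) hfc.stronglyMeasurable
          (integrable_condExp.congr hpull)))
    have h3 : (P x₀)[fun ω => W ω * (Y ω * c) | 𝓕 t]
        =ᵐ[P x₀] fun ω => c * ∫ ω', w (X (s - t) ω') *
          coshFun φ ψ T s (u k) (X (s - t) ω') ∂(P (X t ω)) := by
      have e : (fun ω => w (X s ω) * Y ω * c) = c • fun ω => w (X s ω) * Y ω := by
        ext ω; simp [mul_comm]
      refine (condExp_congr_ae hWY.symm).trans ?_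
      rw [e]
      refine (condExp_smul c _ (𝓕 t)).trans ?_
      filter_upwards [h2] with ω h
      rw [Pi.smul_apply, h, smul_eq_mul]
    filter_upwards [hbayes, h1, h3, hB.ratio hX hφψ hk (ht.trans hs),
      hB.numeraire_pos t (ht.trans hsT)] with ω e1 e2 e3 e4 e5
    rw [e2, e3] at e1
    rw [div_eq_iff e5.ne'] at e4
    rw [e4, ← mul_left_cancel_iff_of_pos hc]
    linear_combination B (N + 1) t ω * e1

/-- The Fourier formula for the price of a claim with payoff `(g(X_s))_+`. -/
lemma IsModifiedAffineLibor.fourier_price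
    (hB : IsModifiedAffineLibor 𝓕 X (P x₀) (momentSet X P (τ (N + 1))) N τ u B)
    (hX : IsAnalyticAffine 𝓕 X P (τ (N + 1))) (hφψ : IsExponentPair X P (τ (N + 1)) φ ψ) {k : ℕ}
    (hk : k ∈ Icc 1 (N + 1)) {s : ℝ≥0} (hs : s ≤ τ k) {J : Finset ℕ} {c : ℕ → ℝ} {g : ℝ → ℝ}
    (hg : ∀ x, coshComb φ ψ (τ (N + 1)) s u J c x = g x * coshFun φ ψ (τ (N + 1)) s (u k) x)
    {κ₁ κ₂ : ℝ} (hκ : IsPayoffInterval g κ₁ κ₂) {W : Ω → ℝ}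
    (hW : W =ᵐ[P x₀] fun ω => max (g (X s ω)) 0) :
    Integrable W (forwardMeasure (P x₀) N τ B k) ∧
    (∀ R : ℝ, (R : ℂ) ∈ momentSet X P (τ (N + 1)) → ∀ t ≤ s,
      (∀ x : D, IntegrableOn (pricingIntegrand X P (s - t)
        ((Ioo κ₁ κ₂).indicator (coshComb φ ψ (τ (N + 1)) s u J c)) R x) (Ioi 0)) ∧
      (fun ω => B k t ω * ((forwardMeasure (P x₀) N τ B k)[W | 𝓕 t]) ω) =ᵐ[P x₀] fun ω =>
        B (N + 1) t ω / Real.pi * ∫ y in Ioi (0 : ℝ), (pricingIntegrand X P (s - t)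
          ((Ioo κ₁ κ₂).indicator (coshComb φ ψ (τ (N + 1)) s u J c)) R (X t ω) y).re) ∧
    (∀ z : ℂ, z ≠ 0 → (∀ j ∈ J, -Complex.I * z + ψ (τ (N + 1) - s) (u j) ≠ 0 ∧
        -Complex.I * z + ψ (τ (N + 1) - s) (-u j) ≠ 0) →
      fourierExt ((Ioo κ₁ κ₂).indicator (coshComb φ ψ (τ (N + 1)) s u J c)) z
        = 1 / (Complex.I * z) *
          ∑ j ∈ J, c j * hFun φ ψ (τ (N + 1)) s κ₁ κ₂ (-Complex.I * z) (u j)) := by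
  have hM := hX.isMarkov
  have hkT : τ k ≤ τ (N + 1) := hB.tenor_mono hk.1 hk.2 le_rfl
  set T := τ (N + 1)
  have hpos := coshFun_pos φ ψ T s (u k)
  have hgeq : g = fun x => coshComb φ ψ T s u J c x / coshFun φ ψ T s (u k) x := by
    ext x
    rw [hg, mul_div_cancel_right₀ _ (hpos x).ne']
  have hgc : Continuous g := by
    rw [hgeq]
    exact (continuous_coshComb _ _ _ _ _ _ _).div (continuous_coshFun _ _ _ _ _)
      fun x => (hpos x).ne'
  have hroot : κ₁ = κ₂ ∨ coshComb φ ψ T s u J c κ₁ = 0 ∧ coshComb φ ψ T s u J c κ₂ = 0 := by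
    refine hκ.eq_or_roots.imp_right fun h => ?_
    rw [hg, hg, h.1, h.2, zero_mul, zero_mul]
    exact ⟨rfl, rfl⟩
  set w : ℝ → ℝ := fun x => max (g x) 0
  have hw : Continuous w := hgc.max continuous_const
  have hwc : HasCompactSupport w := by
    refine HasCompactSupport.intro (isCompact_Icc (a := κ₁) (b := κ₂)) fun x hx => ?_
    simp only [w, hκ.max_eq_indicator]
    exact indicator_of_notMem (fun h => hx (Ioo_subset_Icc_self h)) _
  set f := (Ioo κ₁ κ₂).indicator (coshComb φ ψ T s u J c)
  -- Multiplying the forward-measure payoff by the density factor clears the denominator of `g` and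
  -- leaves the cut-off combination.
  have hf : f = fun x => w x * coshFun φ ψ T s (u k) x := by
    ext x
    simp only [w, hκ.max_eq_indicator, f, indicator_apply]
    split_ifs
    · exact hg x
    · rw [zero_mul]
  have hfc : Continuous f := hf ▸ hw.mul (continuous_coshFun _ _ _ _ _)
  have hfs : HasCompactSupport f := by
    rw [hf]
    exact hwc.mul_right
  obtain ⟨hint, hprice⟩ := hB.price_eq hX hφψ hk hs hw hwc hW
  refine ⟨hint, fun R hR t ht => ?_, fun z hz hne => fourierExt_coshComb hκ.le hroot hz hne⟩
  obtain ⟨C, hC⟩ := exists_norm_fourierExt_coshComb_le hκ.le hroot R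
  have hstT : s - t ≤ T := tsub_le_self.trans (hs.trans hkT)
  have key : ∀ x : D, _ := fun x => integral_eq_integral_fourierExt (μ := P x) hfc hfs hC
    (hM.measurable_coe hstT) (integrable_real_exp hM hstT hR x)
  refine ⟨fun x => (key x).1, (hprice t ht).trans (ae_of_all _ fun ω => ?_)⟩
  have h2 := (key (X t ω)).2
  rw [hf] at h2
  simp only
  rw [h2, ← mul_assoc, mul_one_div, ← hf]
  rfl

end Market

section Derivatives

variable {Ω : Type*} {mΩ : MeasurableSpace Ω} {D : Set ℝ} {𝓕 : Filtration ℝ≥0 mΩ}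
  {X : ℝ≥0 → Ω → D} {P : Kernel D Ω} [IsMarkovKernel P] {x₀ : D} {N : ℕ} {τ : ℕ → ℝ≥0}
  {u : ℕ → ℝ} {B : ℕ → ℝ≥0 → Ω → ℝ} {φ ψ : ℝ≥0 → ℝ → ℝ}

/-! ### Floorlets -/

/-- The weights of `M^{u_k}` and `M^{u_{k+1}}` in the floorlet payoff. -/
def floorletWeight (τ : ℕ → ℝ≥0) (k : ℕ) (K : ℝ) (j : ℕ) : ℝ :=
  if j = k then -1 else 1 + accrual τ (k + 1) * K

lemma coshComb_floorletWeight (φ ψ : ℝ≥0 → ℝ → ℝ) (N : ℕ) (τ : ℕ → ℝ≥0) (u : ℕ → ℝ) (k : ℕ)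
    (K x : ℝ) :
    coshComb φ ψ (τ (N + 1)) (τ k) u {k, k + 1} (floorletWeight τ k K) x
      = (1 + accrual τ (k + 1) * K) * coshFun φ ψ (τ (N + 1)) (τ k) (u (k + 1)) x
        - coshFun φ ψ (τ (N + 1)) (τ k) (u k) x := by
  rw [coshComb, Finset.sum_pair (by omega)]
  simp only [floorletWeight, if_true, if_neg (Nat.succ_ne_self k)]
  ring

lemma floorletFun_eq (φ ψ : ℝ≥0 → ℝ → ℝ) (N : ℕ) (τ : ℕ → ℝ≥0) (u : ℕ → ℝ) (k : ℕ)
    (K κ₁ κ₂ : ℝ) :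
    floorletFun φ ψ N τ u k K κ₁ κ₂ = (Ioo κ₁ κ₂).indicator
      (coshComb φ ψ (τ (N + 1)) (τ k) u {k, k + 1} (floorletWeight τ k K)) := by
  rw [floorletFun]
  congr 1
  ext x
  exact (coshComb_floorletWeight φ ψ N τ u k K x).symm

lemma floorletHat_eq (φ ψ : ℝ≥0 → ℝ → ℝ) (N : ℕ) (τ : ℕ → ℝ≥0) (u : ℕ → ℝ) (k : ℕ)
    (K κ₁ κ₂ : ℝ) (z : ℂ) :
    floorletHat φ ψ N τ u k K κ₁ κ₂ z = 1 / (Complex.I * z) *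
      ∑ j ∈ {k, k + 1}, floorletWeight τ k K j *
        hFun φ ψ (τ (N + 1)) (τ k) κ₁ κ₂ (-Complex.I * z) (u j) := by
  rw [floorletHat, Finset.sum_pair (by omega)]
  simp only [floorletWeight, if_true, if_neg (Nat.succ_ne_self k)]
  push_cast
  ring

/-- For positive `Δ` one has `Δ(K - F) = 1 + ΔK - P(T_k,T_k) / P(T_k,T_{k+1})`, and the bond ratio
is a quotient of two `M`'s. -/
lemma IsModifiedAffineLibor.floorletPayoff_eq
    (hB : IsModifiedAffineLibor 𝓕 X (P x₀) (momentSet X P (τ (N + 1))) N τ u B)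
    (hX : IsAnalyticAffine 𝓕 X P (τ (N + 1))) (hφψ : IsExponentPair X P (τ (N + 1)) φ ψ)
    {k : ℕ} (hk : 1 ≤ k) (hkN : k ≤ N) (K : ℝ) :
    floorletPayoff τ B k K
      =ᵐ[P x₀] fun ω => max (floorletRootFun φ ψ N τ u k K (X (τ k) ω)) 0 := by
  have hkk : τ k ≤ τ (k + 1) := hB.tenor_mono hk (Nat.le_succ k) (by omega)
  -- Zero accrual forces `k = N` and `τ N = τ (N + 1)`. The payoff then carries the factor `0`, and
  -- the root function is `1 - cosh ≤ 0`, so both sides vanish.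
  rcases (hB.accrual_nonneg hk hkN).eq_or_lt with h0 | hpos
  · have heq : τ (k + 1) = τ k := by
      rw [accrual, add_tsub_cancel_right] at h0
      exact NNReal.coe_injective (sub_eq_zero.1 h0.symm)
    have hkN' : k = N := by
      by_contra hne
      have := hB.accrual_pos (k := k + 1) (by omega) (by omega)
      exact this.ne h0
    subst hkN'
    refine ae_of_all _ fun ω => ?_
    obtain ⟨hv, hv'⟩ := hB.mem (k := k) ⟨hk, by omega⟩
    simp only [floorletPayoff, floorletRootFun]
    rw [← h0, zero_mul, zero_mul, ← heq, hφψ.coshFun_self hX hv hv', hB.u_last,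
      hφψ.coshFun_zero hX, max_eq_right]
    have := Real.one_le_cosh (u k * (X (τ (k + 1)) ω : ℝ))
    linarith
  · filter_upwards [hB.ratio hX hφψ (k := k) ⟨hk, by omega⟩ le_rfl,
      hB.ratio hX hφψ (k := k + 1) ⟨by omega, by omega⟩ hkk,
      hB.numeraire_pos (τ k) (hB.tenor_mono hk (by omega) le_rfl)] with ω h1 h2 h3
    have h4 : B k (τ k) ω / B (k + 1) (τ k) ω = coshFun φ ψ (τ (N + 1)) (τ k) (u k) (X (τ k) ω) /
        coshFun φ ψ (τ (N + 1)) (τ k) (u (k + 1)) (X (τ k) ω) := by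
      rw [← h1, ← h2, div_div_div_cancel_right₀ h3.ne']
    simp only [floorletPayoff, floorletRootFun, forwardRate, add_tsub_cancel_right]
    rw [← h4, mul_max_of_nonneg _ _ hpos.le, mul_zero]
    congr 1
    field_simp
    ring

lemma IsModifiedAffineLibor.existsUnique_floorlet
    (hB : IsModifiedAffineLibor 𝓕 X (P x₀) (momentSet X P (τ (N + 1))) N τ u B)
    (hX : IsAnalyticAffine 𝓕 X P (τ (N + 1))) (hφψ : IsExponentPair X P (τ (N + 1)) φ ψ)
    {k : ℕ} (hk : 1 ≤ k) (hkN : k ≤ N) (hu : u (k + 1) < u k) (K : ℝ) :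
    ∃! κ : ℝ × ℝ, IsPayoffInterval (floorletRootFun φ ψ N τ u k K) κ.1 κ.2 := by
  have hu0 : 0 ≤ u (k + 1) := by
    rcases hkN.eq_or_lt with rfl | hlt
    · exact hB.u_last.ge
    · exact hB.u_nonneg _ ⟨by omega, hlt⟩
  obtain ⟨hv, hv'⟩ := hB.mem (k := k) ⟨hk, by omega⟩
  have := (hφψ.existsUnique_isPayoffInterval (t := τ k) (u := u) (J := {k + 1})
    (c := fun _ => 1) hX hv hv' hu (by simpa using hu0) (by simp) (by simp)).1
    (1 + accrual τ (k + 1) * K)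
  simp only [coshComb, Finset.sum_singleton, one_mul] at this
  exact this

/-! ### Put swaptions -/

/-- The weights of the `M^{u_j}`, `α < j ≤ β`, in the swaption payoff. -/
def swaptionTailWeight (τ : ℕ → ℝ≥0) (β : ℕ) (K : ℝ) (j : ℕ) : ℝ :=
  K * accrual τ j + if j = β then 1 else 0

/-- The weights of the `M^{u_j}`, `α ≤ j ≤ β`, in the swaption payoff. -/
def swaptionWeight (τ : ℕ → ℝ≥0) (α β : ℕ) (K : ℝ) (j : ℕ) : ℝ :=
  if j = α then -1 else swaptionTailWeight τ β K j

/-- The ring homomorphism allows one computation to serve both the real payoff functions and their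
complex transforms. -/
lemma sum_swaptionTailWeight {A : Type*} [CommRing A] (ι : ℝ →+* A) (τ : ℕ → ℝ≥0) {α β : ℕ}
    (hαβ : α < β) (K : ℝ) (F : ℕ → A) :
    ∑ j ∈ Finset.Icc (α + 1) β, ι (swaptionTailWeight τ β K j) * F j
      = F β + ∑ j ∈ Finset.Icc (α + 1) β, ι (K * accrual τ j) * F j := by
  simp only [swaptionTailWeight, map_add, add_mul, Finset.sum_add_distrib]
  rw [add_comm]
  congr 1
  rw [Finset.sum_eq_single β]
  · simp
  · intro j _ hj
    simp [hj]
  · intro h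
    exact absurd (Finset.mem_Icc.2 ⟨by omega, le_rfl⟩) h

lemma sum_swaptionWeight {A : Type*} [CommRing A] (ι : ℝ →+* A) (τ : ℕ → ℝ≥0) {α β : ℕ}
    (hαβ : α < β) (K : ℝ) (F : ℕ → A) :
    ∑ j ∈ Finset.Icc α β, ι (swaptionWeight τ α β K j) * F j
      = F β - F α + ∑ j ∈ Finset.Icc (α + 1) β, ι (K * accrual τ j) * F j := by
  rw [← Finset.insert_Icc_add_one_left_eq_Icc hαβ.le, Finset.sum_insert (by simp),
    Finset.sum_congr rfl (g := fun j => ι (swaptionTailWeight τ β K j) * F j) fun j hj => ?_,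
    sum_swaptionTailWeight ι τ hαβ]
  · simp only [swaptionWeight, if_true, map_neg, map_one]
    ring
  · rw [swaptionWeight, if_neg]
    have := (Finset.mem_Icc.1 hj).1
    omega

lemma swaptionRootFun_eq (φ ψ : ℝ≥0 → ℝ → ℝ) (N : ℕ) (τ : ℕ → ℝ≥0) (u : ℕ → ℝ) {α β : ℕ}
    (hαβ : α < β) (K : ℝ) :
    swaptionRootFun φ ψ N τ u α β K = fun x =>
      coshComb φ ψ (τ (N + 1)) (τ α) u (Finset.Icc (α + 1) β) (swaptionTailWeight τ β K) x
        / coshFun φ ψ (τ (N + 1)) (τ α) (u α) x - 1 := by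
  ext x
  have := sum_swaptionTailWeight (RingHom.id ℝ) τ hαβ K
    fun j => coshFun φ ψ (τ (N + 1)) (τ α) (u j) x
  simp only [RingHom.id_apply] at this
  rw [coshComb, this, swaptionRootFun, add_div, Finset.sum_div]
  simp only [mul_div_assoc]

lemma coshComb_swaptionWeight (φ ψ : ℝ≥0 → ℝ → ℝ) (N : ℕ) (τ : ℕ → ℝ≥0) (u : ℕ → ℝ) {α β : ℕ}
    (hαβ : α < β) (K x : ℝ) :
    coshComb φ ψ (τ (N + 1)) (τ α) u (Finset.Icc α β) (swaptionWeight τ α β K) x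
      = swaptionRootFun φ ψ N τ u α β K x * coshFun φ ψ (τ (N + 1)) (τ α) (u α) x := by
  have hpos := coshFun_pos φ ψ (τ (N + 1)) (τ α) (u α) x
  have h1 := sum_swaptionTailWeight (RingHom.id ℝ) τ hαβ K
    fun j => coshFun φ ψ (τ (N + 1)) (τ α) (u j) x
  have h2 := sum_swaptionWeight (RingHom.id ℝ) τ hαβ K
    fun j => coshFun φ ψ (τ (N + 1)) (τ α) (u j) x
  simp only [RingHom.id_apply] at h1 h2
  rw [swaptionRootFun_eq φ ψ N τ u hαβ]
  simp only [coshComb]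
  rw [h2, h1]
  field_simp
  ring

lemma swaptionFun_eq (φ ψ : ℝ≥0 → ℝ → ℝ) (N : ℕ) (τ : ℕ → ℝ≥0) (u : ℕ → ℝ) {α β : ℕ}
    (hαβ : α < β) (K κ₁ κ₂ : ℝ) :
    swaptionFun φ ψ N τ u α β K κ₁ κ₂ = (Ioo κ₁ κ₂).indicator
      (coshComb φ ψ (τ (N + 1)) (τ α) u (Finset.Icc α β) (swaptionWeight τ α β K)) := by
  rw [swaptionFun]
  congr 1
  ext x
  exact (sum_swaptionWeight (RingHom.id ℝ) τ hαβ K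
    fun j => coshFun φ ψ (τ (N + 1)) (τ α) (u j) x).symm

lemma swaptionHat_eq (φ ψ : ℝ≥0 → ℝ → ℝ) (N : ℕ) (τ : ℕ → ℝ≥0) (u : ℕ → ℝ) {α β : ℕ}
    (hαβ : α < β) (K κ₁ κ₂ : ℝ) (z : ℂ) :
    swaptionHat φ ψ N τ u α β K κ₁ κ₂ z = 1 / (Complex.I * z) *
      ∑ j ∈ Finset.Icc α β, swaptionWeight τ α β K j *
        hFun φ ψ (τ (N + 1)) (τ α) κ₁ κ₂ (-Complex.I * z) (u j) := by
  have := sum_swaptionWeight Complex.ofRealHom τ hαβ K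
    fun j => hFun φ ψ (τ (N + 1)) (τ α) κ₁ κ₂ (-Complex.I * z) (u j)
  simp only [Complex.ofRealHom_eq_coe] at this
  rw [swaptionHat, this, Finset.mul_sum]
  simp only [Complex.ofReal_mul, mul_assoc]

lemma IsModifiedAffineLibor.putSwaptionPayoff_eq
    (hB : IsModifiedAffineLibor 𝓕 X (P x₀) (momentSet X P (τ (N + 1))) N τ u B)
    (hX : IsAnalyticAffine 𝓕 X P (τ (N + 1))) (hφψ : IsExponentPair X P (τ (N + 1)) φ ψ)
    {α β : ℕ} (hα : 1 ≤ α) (hαβ : α < β) (hβ : β ≤ N) (K : ℝ) :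
    putSwaptionPayoff τ B α β K
      =ᵐ[P x₀] fun ω => max (swaptionRootFun φ ψ N τ u α β K (X (τ α) ω)) 0 := by
  have hall : ∀ᵐ ω ∂(P x₀), ∀ j ∈ Finset.Icc α β,
      B j (τ α) ω / B (N + 1) (τ α) ω = coshFun φ ψ (τ (N + 1)) (τ α) (u j) (X (τ α) ω) := by
    rw [Filter.eventually_all_finset]
    intro j hj
    obtain ⟨h1, h2⟩ := Finset.mem_Icc.1 hj
    exact hB.ratio hX hφψ ⟨by omega, by omega⟩ (hB.tenor_mono hα h1 (by omega))
  filter_upwards [hall, hB.bond_maturity α ⟨hα, by omega⟩,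
    hB.numeraire_pos (τ α) (hB.tenor_mono hα (by omega) le_rfl)] with ω h1 h2 h3
  set x : ℝ := (X (τ α) ω : ℝ)
  have hMα : coshFun φ ψ (τ (N + 1)) (τ α) (u α) x = 1 / B (N + 1) (τ α) ω := by
    rw [← h1 α (Finset.mem_Icc.2 ⟨le_rfl, hαβ.le⟩), h2]
  have hBj : ∀ j ∈ Finset.Icc (α + 1) β, coshFun φ ψ (τ (N + 1)) (τ α) (u j) x
      / coshFun φ ψ (τ (N + 1)) (τ α) (u α) x = B j (τ α) ω := by
    intro j hj
    obtain ⟨hj1, hj2⟩ := Finset.mem_Icc.1 hj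
    rw [hMα, ← h1 j (Finset.mem_Icc.2 ⟨by omega, hj2⟩)]
    field_simp
  have hmem : β ∈ Finset.Icc (α + 1) β := Finset.mem_Icc.2 ⟨by omega, le_rfl⟩
  -- Positivity of the annuity lets it move inside the positive part, where it cancels the
  -- denominator of the swap rate.
  have hpos : 0 < ∑ k ∈ Finset.Icc (α + 1) β, accrual τ k * B k (τ α) ω := by
    refine Finset.sum_pos (fun j hj => ?_) ⟨β, hmem⟩
    obtain ⟨hj1, hj2⟩ := Finset.mem_Icc.1 hj
    rw [← hBj j hj]
    exact mul_pos (hB.accrual_pos (by omega) (by omega))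
      (div_pos (coshFun_pos _ _ _ _ _ _) (coshFun_pos _ _ _ _ _ _))
  have e1 : putSwaptionPayoff τ B α β K ω = (∑ k ∈ Finset.Icc (α + 1) β,
      accrual τ k * B k (τ α) ω) * max (K - swapRate τ B α β (τ α) ω) 0 := by
    rw [putSwaptionPayoff, ← Finset.sum_mul]
    simp only [mul_comm]
  have e2 : swaptionRootFun φ ψ N τ u α β K x
      = B β (τ α) ω + K * (∑ k ∈ Finset.Icc (α + 1) β, accrual τ k * B k (τ α) ω) - 1 := by
    rw [swaptionRootFun, hBj β hmem, Finset.mul_sum]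
    congr 2
    exact Finset.sum_congr rfl fun j hj => by rw [hBj j hj, mul_assoc]
  rw [e1, e2, mul_max_of_nonneg _ _ hpos.le, mul_zero, swapRate, h2]
  congr 1
  field_simp
  ring

lemma IsModifiedAffineLibor.existsUnique_swaption
    (hB : IsModifiedAffineLibor 𝓕 X (P x₀) (momentSet X P (τ (N + 1))) N τ u B)
    (hX : IsAnalyticAffine 𝓕 X P (τ (N + 1))) (hφψ : IsExponentPair X P (τ (N + 1)) φ ψ)
    {α β : ℕ} (hα : 1 ≤ α) (hαβ : α < β) (hβ : β ≤ N) {K : ℝ} (hK : 0 ≤ K) :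
    ∃! κ : ℝ × ℝ, IsPayoffInterval (swaptionRootFun φ ψ N τ u α β K) κ.1 κ.2 := by
  obtain ⟨hv, hv'⟩ := hB.mem (k := α) ⟨hα, by omega⟩
  rw [swaptionRootFun_eq φ ψ N τ u hαβ]
  have hacc : ∀ j ∈ Finset.Icc (α + 1) β, 0 ≤ K * accrual τ j := by
    intro j hj
    obtain ⟨hj1, hj2⟩ := Finset.mem_Icc.1 hj
    exact mul_nonneg hK (hB.accrual_pos (by omega) (by omega)).le
  have hmem : β ∈ Finset.Icc (α + 1) β := Finset.mem_Icc.2 ⟨by omega, le_rfl⟩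
  -- `u (α + 1)` is the largest parameter in the denominator. The weights are nonnegative because `K
  -- ≥ 0`, and that of `β` is at least `1`.
  refine (hφψ.existsUnique_isPayoffInterval (t := τ α) (u := u) hX hv hv' (m := u (α + 1))
    (hB.u_strictAnti ⟨hα, by omega⟩ ⟨by omega, by omega⟩ (Nat.lt_succ_self α))
    (fun j hj => ?_) (fun j hj => ?_) ⟨β, hmem, ?_⟩).2
  · obtain ⟨hj1, hj2⟩ := Finset.mem_Icc.1 hj
    exact ⟨hB.u_nonneg j ⟨by omega, by omega⟩,
      hB.u_strictAnti.antitoneOn ⟨by omega, by omega⟩ ⟨by omega, by omega⟩ hj1⟩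
  · refine add_nonneg (hacc j hj) ?_
    split_ifs <;> norm_num
  · rw [swaptionTailWeight, if_pos rfl]
    linarith [hacc β hmem]

end Derivatives

end AffineLibor

end

/-! ### Assembly of the theorem -/

theorem mainTheorem1 {Ω : Type*} {mΩ : MeasurableSpace Ω} {D : Set ℝ}
    (𝓕 : Filtration ℝ≥0 mΩ) (X : ℝ≥0 → Ω → D) (P : Kernel D Ω) [IsMarkovKernel P] (x₀ : D)
    (N : ℕ) (τ : ℕ → ℝ≥0) (u : ℕ → ℝ) (B : ℕ → ℝ≥0 → Ω → ℝ)
    (hX : AffineLibor.IsAnalyticAffine 𝓕 X P (τ (N + 1)))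
    (hB : AffineLibor.IsModifiedAffineLibor 𝓕 X (P x₀)
      (AffineLibor.momentSet X P (τ (N + 1))) N τ u B) :
    -- the exponents of the affine process exist at the real points of `𝒱`
    (∃ φ ψ : ℝ≥0 → ℝ → ℝ, AffineLibor.IsExponentPair X P (τ (N + 1)) φ ψ) ∧
    -- the conditional moment generating function
    (∀ s t : ℝ≥0, s ≤ t → t ≤ τ (N + 1) → ∀ z ∈ AffineLibor.momentSet X P (τ (N + 1)),
      (P x₀)[fun ω => Complex.exp (z * ((X t ω : ℝ) : ℂ)) | 𝓕 s]
        =ᵐ[P x₀] fun ω => AffineLibor.mgfFrom X P (t - s) z (X s ω)) ∧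
    -- the forward measures are probability measures
    (∀ k ∈ Icc 1 (N + 1), IsProbabilityMeasure (AffineLibor.forwardMeasure (P x₀) N τ B k)) ∧
    ∀ φ ψ : ℝ≥0 → ℝ → ℝ, AffineLibor.IsExponentPair X P (τ (N + 1)) φ ψ →
      -- the bond ratios
      (∀ k ∈ Icc 1 N, ∀ t ≤ τ k,
        (fun ω => B k t ω / B (N + 1) t ω)
          =ᵐ[P x₀] fun ω => AffineLibor.coshFun φ ψ (τ (N + 1)) t (u k) (X t ω : ℝ)) ∧
      -- floorlets
      (∀ (K : ℝ) (k : ℕ), 1 ≤ k → k ≤ N → u (k + 1) < u k →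
        Integrable (AffineLibor.floorletPayoff τ B k K)
          (AffineLibor.forwardMeasure (P x₀) N τ B (k + 1)) ∧
        (∃! κ : ℝ × ℝ, AffineLibor.IsPayoffInterval
          (AffineLibor.floorletRootFun φ ψ N τ u k K) κ.1 κ.2) ∧
        ∀ κ₁ κ₂ : ℝ, AffineLibor.IsPayoffInterval
            (AffineLibor.floorletRootFun φ ψ N τ u k K) κ₁ κ₂ →
          (∀ R : ℝ, (R : ℂ) ∈ AffineLibor.momentSet X P (τ (N + 1)) → ∀ t ≤ τ k,
            (∀ x : D, IntegrableOn (AffineLibor.pricingIntegrand X P (τ k - t)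
              (AffineLibor.floorletFun φ ψ N τ u k K κ₁ κ₂) R x) (Ioi 0)) ∧
            AffineLibor.floorletPrice 𝓕 (P x₀) N τ B t k K =ᵐ[P x₀] fun ω =>
              B (N + 1) t ω / Real.pi * ∫ y in Ioi (0 : ℝ),
                (AffineLibor.pricingIntegrand X P (τ k - t)
                  (AffineLibor.floorletFun φ ψ N τ u k K κ₁ κ₂) R (X t ω) y).re) ∧
          (∀ z : ℂ, z ≠ 0 →
            (∀ j ∈ Icc k (k + 1), -Complex.I * z + ψ (τ (N + 1) - τ k) (u j) ≠ 0 ∧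
              -Complex.I * z + ψ (τ (N + 1) - τ k) (-u j) ≠ 0) →
            AffineLibor.fourierExt (AffineLibor.floorletFun φ ψ N τ u k K κ₁ κ₂) z
              = AffineLibor.floorletHat φ ψ N τ u k K κ₁ κ₂ z)) ∧
      -- put swaptions
      (∀ (K : ℝ) (α β : ℕ), 0 ≤ K → 1 ≤ α → α < β → β ≤ N →
        Integrable (AffineLibor.putSwaptionPayoff τ B α β K)
          (AffineLibor.forwardMeasure (P x₀) N τ B α) ∧
        (∃! κ : ℝ × ℝ, AffineLibor.IsPayoffInterval
          (AffineLibor.swaptionRootFun φ ψ N τ u α β K) κ.1 κ.2) ∧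
        ∀ κ₁ κ₂ : ℝ, AffineLibor.IsPayoffInterval
            (AffineLibor.swaptionRootFun φ ψ N τ u α β K) κ₁ κ₂ →
          (∀ R : ℝ, (R : ℂ) ∈ AffineLibor.momentSet X P (τ (N + 1)) → ∀ t ≤ τ α,
            (∀ x : D, IntegrableOn (AffineLibor.pricingIntegrand X P (τ α - t)
              (AffineLibor.swaptionFun φ ψ N τ u α β K κ₁ κ₂) R x) (Ioi 0)) ∧
            AffineLibor.putSwaptionPrice 𝓕 (P x₀) N τ B t α β K =ᵐ[P x₀] fun ω =>
              B (N + 1) t ω / Real.pi * ∫ y in Ioi (0 : ℝ),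
                (AffineLibor.pricingIntegrand X P (τ α - t)
                  (AffineLibor.swaptionFun φ ψ N τ u α β K κ₁ κ₂) R (X t ω) y).re) ∧
          (∀ z : ℂ, z ≠ 0 →
            (∀ j ∈ Icc α β, -Complex.I * z + ψ (τ (N + 1) - τ α) (u j) ≠ 0 ∧
              -Complex.I * z + ψ (τ (N + 1) - τ α) (-u j) ≠ 0) →
            AffineLibor.fourierExt (AffineLibor.swaptionFun φ ψ N τ u α β K κ₁ κ₂) z
              = AffineLibor.swaptionHat φ ψ N τ u α β K κ₁ κ₂ z)) := by

  obtain ⟨φ₀, ψ₀, h₀⟩ := hX.exists_isExponentPair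
  refine ⟨⟨φ₀, ψ₀, h₀⟩, fun s t hst ht z hz =>
    AffineLibor.condExp_exp hX.isMarkov x₀ hst ht hz,
    fun k hk => hB.isProbabilityMeasure hX h₀ hk, fun φ ψ hφψ => ⟨fun k hk t ht =>
      hB.ratio hX hφψ ⟨hk.1, hk.2.trans (Nat.le_succ N)⟩ ht, fun K k hk hkN hu => ?_,
    fun K α β hK hα hαβ hβ => ?_⟩⟩
  -- The floorlet is priced under the forward measure of index `k + 1`, but its payoff depends on
  -- `X` at the earlier date `τ k`.
  · have key : ∀ {κ₁ κ₂ : ℝ}, _ → _ := fun {κ₁ κ₂} hκ =>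
      hB.fourier_price hX hφψ (k := k + 1) ⟨Nat.le_add_left 1 k, Nat.succ_le_succ hkN⟩
        (hB.tenor_mono hk (Nat.le_succ k) (Nat.succ_le_succ hkN)) (J := {k, k + 1})
        (c := AffineLibor.floorletWeight τ k K) (g := AffineLibor.floorletRootFun φ ψ N τ u k K)
        (fun x => by
          rw [AffineLibor.coshComb_floorletWeight, AffineLibor.floorletRootFun, sub_mul,
            div_mul_cancel₀ _ (AffineLibor.coshFun_pos _ _ _ _ _ _).ne'])
        (κ₁ := κ₁) (κ₂ := κ₂) hκ (hB.floorletPayoff_eq hX hφψ hk hkN K)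
    have hex := hB.existsUnique_floorlet hX hφψ hk hkN hu K
    refine ⟨(key hex.choose_spec.1).1, hex, fun κ₁ κ₂ hκ => ?_⟩
    obtain ⟨-, hprice, hhat⟩ := key hκ
    rw [AffineLibor.floorletFun_eq]
    refine ⟨hprice, fun z hz hne => ?_⟩
    rw [AffineLibor.floorletHat_eq]
    refine hhat z hz fun j hj => hne j ?_
    rw [Finset.mem_insert, Finset.mem_singleton] at hj
    rcases hj with rfl | rfl
    · exact ⟨le_rfl, Nat.le_succ _⟩
    · exact ⟨Nat.le_succ _, le_rfl⟩
  · have key : ∀ {κ₁ κ₂ : ℝ}, _ → _ := fun {κ₁ κ₂} hκ =>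
      hB.fourier_price hX hφψ (k := α) ⟨hα, by omega⟩ le_rfl
        (fun x => AffineLibor.coshComb_swaptionWeight φ ψ N τ u hαβ K x)
        (κ₁ := κ₁) (κ₂ := κ₂) hκ (hB.putSwaptionPayoff_eq hX hφψ hα hαβ hβ K)
    have hex := hB.existsUnique_swaption hX hφψ hα hαβ hβ hK
    -- Integrability does not involve the interval, but its proof uses boundedness of the payoff,
    -- which comes from any existing interval.
    refine ⟨(key hex.choose_spec.1).1, hex, fun κ₁ κ₂ hκ => ?_⟩
    obtain ⟨-, hprice, hhat⟩ := key hκ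
    rw [AffineLibor.swaptionFun_eq φ ψ N τ u hαβ]
    refine ⟨hprice, fun z hz hne => ?_⟩
    rw [AffineLibor.swaptionHat_eq φ ψ N τ u hαβ]
    exact hhat z hz fun j hj => hne j (Finset.mem_Icc.1 hj)
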